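/- **Setting.** Let $d\ge 1$, $r_1,\dots,r_d\in\{1,2,\dots\}$, and let $\mathcal R=[r_1]\times\cdots\times[r_d]$, where $[s]=\{1,\dots,s\}$. For an array $a=(a_i)_{i\in\mathcal R}$ of real numbers, $\mathrm{Supp}(a)=\{i: a_i\ne 0\}$, and its margins are $a^{(\ell)}_j=\sum_{i\in\mathcal R:\, i_\ell=j}a_i$ for $\ell\in[d]$, $j\in[r_\ell]$. Let $\mathcal P$ be the set of arrays with entries in $[0,1]$, total sum $1$ and all margins $p^{(\ell)}_j>0$; let $\Gamma=\{\gamma\in\mathcal P:\gamma^{(\ell)}_j=1/r_\ell\ \forall \ell,j\}$ be the set of copula arrays, and, for $S\subseteq\mathcal R$, let $\mathcal P(S)$ and $\Gamma(S)$ be the sets of arrays of $\mathcal P$ and of $\Gamma$ with support equal to $S$. For $q,p\in\mathcal P$ let $\mathcal I(q\|p)=\sum_{i\in\mathrm{Supp}(p)}q_i\log(q_i/p_i)$ if $\mathrm{Supp}(q)\subseteq\mathrm{Supp}(p)$ (with $0\log 0=0$), and $\mathcal I(q\|p)=\infty$ otherwise. An $\mathcal I$-projection of $p$ on $\Gamma$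 is an element of $\Gamma$ attaining $\inf_{\gamma\in\Gamma}\mathcal I(\gamma\|p)$; it is denoted $\mathcal I_\Gamma(p)$ when it is unique. Let $\Delta^\circ(S)$ be the linear space of arrays with support included in $S$ and with all margins null. Arrays are identified with vectors indexed by $\mathcal R$; underlining denotes this vectorisation. Let $P$ be a probability distribution on a grid $\mathcal X_1\times\cdots\times\mathcal X_d$, where $\mathcal X_\ell=\{x^{(\ell)}_1<\dots<x^{(\ell)}_{r_\ell}\}\subset\mathbb R$, whose probability array $p_i=P(\{(x^{(1)}_{i_1},\dots,x^{(d)}_{i_d})\})$ belongs to $\mathcal P$, and write $S_p=\mathrm{Supp}(p)$. Let $X_1,X_2,\dots$ be random vectors on a common probability space, each with law $P$ (independence is assumed only in (c)). Let $p_n$ be the array of empirical proportions of $X_1,\dots,X_n$, and set $$\hat p_n=\tfrac{n}{n+1}\,p_n+\tfrac1{n+1}\,q,\qquad q_i=\tfrac1{|S_p|}\mathbf 1\{i\in S_p\}.$$ **Theorem.** Assume $\Gamma(S_p)\ne\emptyset$. Then every element of $\mathcal P(S_p)$ has exactly one $\mathcal I$-projection on $\Gamma$. Let $\gamma_p=\mathcal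 I_\Gamma(p)$ be the copula array of $p$, and let $\hat\gamma_n=\mathcal I_\Gamma(\hat p_n)$ be the empirical copula array (well defined almost surely). (a) If $\hat p_n\to p$ in probability, then $\hat\gamma_n\to\gamma_p$ in probability. If $\hat p_n\to p$ almost surely, then $\hat\gamma_n\to\gamma_p$ almost surely. Assume moreover that $d_\circ=\dim\Delta^\circ(S_p)\ge 1$. Let $A$ be any matrix whose columns are the vectorised elements of a basis of $\Delta^\circ(S_p)$, let $R$ be the matrix made of the rows of the identity matrix with index in $S_p$, and let $\tilde A=RA$. Put $$J=A\left[\tilde A^{\top}\mathrm{diag}^{-1}(R\underline{\gamma}_p)\tilde A\right]^{-1}\tilde A^{\top}\mathrm{diag}^{-1}(R\underline p)\,R .$$ Then $J$ is a Jacobian matrix at $\underline p$ of the map $\underline\gamma^*:\underline{p}'\mapsto\underline{\mathcal I_\Gamma(p')}$ on $\mathcal P(S_p)$, that is, $\underline\gamma^*(\underline p')-\underline\gamma^*(\underline p)=J(\underline p'-\underline p)+o(\|\underline p'-\underline p\|)$ as $p'\to p$ within $\mathcal P(S_p)$. Moreover: (b) If $\rho_n(\underline{\hat p}_n-\underline p)\to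 Z$ in law for some real numbers $\rho_n\to\infty$ and some random vector $Z$, then $\rho_n(\underline{\hat\gamma}_n-\underline\gamma_p)\to JZ$ in law. (c) If $X_1,X_2,\dots$ are independent (hence i.i.d. with law $P$), then $\sqrt n(\underline{\hat p}_n-\underline p)\to\mathcal N(0,\mathrm{diag}(\underline p)-\underline p\,\underline p^{\top})$ in law and $\sqrt n(\underline{\hat\gamma}_n-\underline\gamma_p)\to\mathcal N(0,\Sigma_\gamma)$ in law, where $\Sigma_\gamma=A\Sigma_\theta A^{\top}$ and $$\Sigma_\theta=\left[\tilde A^{\top}\mathrm{diag}^{-1}(R\underline\gamma_p)\tilde A\right]^{-1}\left[\tilde A^{\top}\mathrm{diag}^{-1}(R\underline p)\tilde A\right]\left[\tilde A^{\top}\mathrm{diag}^{-1}(R\underline\gamma_p)\tilde A\right]^{-1};$$ both matrices $\mathrm{diag}(\underline p)-\underline p\,\underline p^{\top}$ and $\Sigma_\gamma$ are positive semidefinite. -/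

import Mathlib

open MeasureTheory ProbabilityTheory Filter Topology

noncomputable section

/-- The index set `[r 1] × ⋯ × [r d]` of the cells of a `d`-dimensional array. -/
abbrev Cell {d : ℕ} (r : Fin d → ℕ) : Type := (l : Fin d) → Fin (r l)

/-- The `d`-dimensional real arrays of dimension sizes `r 1, …, r d`. -/
abbrev RArray {d : ℕ} (r : Fin d → ℕ) : Type := Cell r → ℝ

/-- The vectorised arrays; their coordinates are labelled by the cells themselves. -/
abbrev VecSpace {d : ℕ} (r : Fin d → ℕ) : Type := EuclideanSpace ℝ (Cell r)

/-- Vectorisation of an array. -/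
def vec {d : ℕ} {r : Fin d → ℕ} (a : RArray r) : VecSpace r := WithLp.toLp 2 a

/-- The array with a given vectorisation. -/
def unvec {d : ℕ} {r : Fin d → ℕ} (v : VecSpace r) : RArray r := WithLp.ofLp v

/-- The support of an array. -/
def supp {d : ℕ} {r : Fin d → ℕ} (a : RArray r) : Finset (Cell r) :=
  Finset.univ.filter fun i => a i ≠ 0

/-- The `i`-th entry of the `l`-th margin of an array: the sum of its entries over all the
dimensions but the `l`-th one. -/
def margin {d : ℕ} {r : Fin d → ℕ} (a : RArray r) (l : Fin d) (i : Fin (r l)) : ℝ :=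
  ∑ j ∈ Finset.univ.filter (fun j : Cell r => j l = i), a j

/-- The probability arrays with no identically null slice. -/
def probArrays {d : ℕ} (r : Fin d → ℕ) : Set (RArray r) :=
  {p | (∀ i, p i ∈ Set.Icc (0 : ℝ) 1) ∧ ∑ i, p i = 1 ∧ ∀ l i, 0 < margin p l i}

/-- The probability arrays with support `S`. -/
def probArraysOn {d : ℕ} {r : Fin d → ℕ} (S : Finset (Cell r)) : Set (RArray r) :=
  {p | p ∈ probArrays r ∧ supp p = S}

/-- The Fréchet class of the probability arrays with margins `q 1, …, q d`. -/
def frechetClass {d : ℕ} {r : Fin d → ℕ} (q : (l : Fin d) → Fin (r l) → ℝ) : Set (RArray r) :=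
  {p | p ∈ probArrays r ∧ ∀ l i, margin p l i = q l i}

/-- The copula arrays: the probability arrays with uniform margins. -/
def copulaArrays {d : ℕ} (r : Fin d → ℕ) : Set (RArray r) :=
  frechetClass fun l _ => 1 / (r l : ℝ)

/-- The copula arrays with support `S`. -/
def copulaArraysOn {d : ℕ} {r : Fin d → ℕ} (S : Finset (Cell r)) : Set (RArray r) :=
  {g | g ∈ copulaArrays r ∧ supp g = S}

open Classical in
/-- The `I`-divergence of `q` with respect to `p` (`0 * log 0 = 0` holds in `ℝ`). -/
def iDiv {d : ℕ} {r : Fin d → ℕ} (q p : RArray r) : EReal :=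
  if supp q ⊆ supp p then ((∑ i ∈ supp p, q i * Real.log (q i / p i) : ℝ) : EReal) else ⊤

/-- `q` is an `I`-projection of `p` on the set `F` of arrays. -/
def IsIProjection {d : ℕ} {r : Fin d → ℕ} (F : Set (RArray r)) (p q : RArray r) : Prop :=
  q ∈ F ∧ iDiv q p = ⨅ q' ∈ F, iDiv q' p

open Classical in
/-- The copula array of `p`: its `I`-projection on the copula arrays
(the zero array if there is none). -/
def copulaArray {d : ℕ} {r : Fin d → ℕ} (p : RArray r) : RArray r :=
  if h : ∃ g, IsIProjection (copulaArrays r) p g then h.choose else 0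

/-- The map sending the vectorisation of `p` to the vectorisation of the copula array of `p`. -/
def copulaMap {d : ℕ} {r : Fin d → ℕ} (v : VecSpace r) : VecSpace r := vec (copulaArray (unvec v))

/-- The linear space of the arrays which vanish outside `S` and whose margins are all null. -/
def nullMarginSpace {d : ℕ} {r : Fin d → ℕ} (S : Finset (Cell r)) : Submodule ℝ (RArray r) where
  carrier := {a | supp a ⊆ S ∧ ∀ l i, margin a l i = 0}
  zero_mem' := by simp [supp, margin]
  add_mem' := by
    rintro a b ⟨ha, ha'⟩ ⟨hb, hb'⟩
    refine ⟨fun i hi => ?_, fun l i => ?_⟩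
    · by_contra hS
      have h1 : a i = 0 := by
        by_contra h
        exact hS (ha (by simp [supp, h]))
      have h2 : b i = 0 := by
        by_contra h
        exact hS (hb (by simp [supp, h]))
      simp [supp, h1, h2] at hi
    · have h1 := ha' l i
      have h2 := hb' l i
      simp only [margin] at h1 h2
      simp [margin, Finset.sum_add_distrib, h1, h2]
  smul_mem' := by
    rintro c a ⟨ha, ha'⟩
    refine ⟨fun i hi => ha ?_, fun l i => ?_⟩
    · simp only [supp, Finset.mem_filter, Finset.mem_univ, true_and, Pi.smul_apply, smul_eq_mul,
        ne_eq, mul_eq_zero, not_or] at hi ⊢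
      exact hi.2
    · have h1 := ha' l i
      simp only [margin] at h1
      simp [margin, ← Finset.mul_sum, h1]

/-- The matrix whose columns are the vectorised elements of a basis of `nullMarginSpace S`. -/
def basisMatrix {d : ℕ} {r : Fin d → ℕ} {S : Finset (Cell r)} {k : ℕ}
    (b : Module.Basis (Fin k) ℝ (nullMarginSpace S)) : Matrix (Cell r) (Fin k) ℝ :=
  Matrix.of fun i m => (b m : RArray r) i

/-- The entry selection matrix: the rows of the identity matrix with index in `S`. -/
def selMatrix {d : ℕ} {r : Fin d → ℕ} (S : Finset (Cell r)) : Matrix S (Cell r) ℝ :=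
  (1 : Matrix (Cell r) (Cell r) ℝ).submatrix Subtype.val id

/-- The basis matrix restricted to its rows with index in `S`. -/
def redMatrix {d : ℕ} {r : Fin d → ℕ} {S : Finset (Cell r)} {k : ℕ}
    (b : Module.Basis (Fin k) ℝ (nullMarginSpace S)) : Matrix S (Fin k) ℝ :=
  selMatrix S * basisMatrix b

/-- The inverse of the diagonal matrix with (nonzero) diagonal entries `v`. -/
def diagInv {ι : Type*} [DecidableEq ι] (v : ι → ℝ) : Matrix ι ι ℝ :=
  Matrix.diagonal fun i => (v i)⁻¹

open Matrix in
/-- The matrix `Ãᵀ diag⁻¹(R v) Ã`. -/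
def infoMatrix {d : ℕ} {r : Fin d → ℕ} {S : Finset (Cell r)} {k : ℕ}
    (b : Module.Basis (Fin k) ℝ (nullMarginSpace S)) (v : RArray r) : Matrix (Fin k) (Fin k) ℝ :=
  (redMatrix b)ᵀ * diagInv (selMatrix S *ᵥ v) * redMatrix b

open Matrix in
/-- The Jacobian matrix `A [Ãᵀ diag⁻¹(R γ) Ã]⁻¹ Ãᵀ diag⁻¹(R p) R` at `p`, where `γ` is the copula
array of `p`. -/
def copulaJacobian {d : ℕ} {r : Fin d → ℕ} {S : Finset (Cell r)} {k : ℕ}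
    (b : Module.Basis (Fin k) ℝ (nullMarginSpace S)) (p : RArray r) :
    Matrix (Cell r) (Cell r) ℝ :=
  basisMatrix b * (infoMatrix b (copulaArray p))⁻¹ * (redMatrix b)ᵀ *
    diagInv (selMatrix S *ᵥ p) * selMatrix S

/-- `[Ãᵀ diag⁻¹(R γ) Ã]⁻¹ [Ãᵀ diag⁻¹(R p) Ã] [Ãᵀ diag⁻¹(R γ) Ã]⁻¹`, where `γ` is the copula array
of `p`. -/
def sigmaTheta {d : ℕ} {r : Fin d → ℕ} {S : Finset (Cell r)} {k : ℕ}
    (b : Module.Basis (Fin k) ℝ (nullMarginSpace S)) (p : RArray r) :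
    Matrix (Fin k) (Fin k) ℝ :=
  (infoMatrix b (copulaArray p))⁻¹ * infoMatrix b p * (infoMatrix b (copulaArray p))⁻¹

open Matrix in
/-- The sandwich covariance matrix `A Σ_θ Aᵀ`. -/
def sigmaGamma {d : ℕ} {r : Fin d → ℕ} {S : Finset (Cell r)} {k : ℕ}
    (b : Module.Basis (Fin k) ℝ (nullMarginSpace S)) (p : RArray r) :
    Matrix (Cell r) (Cell r) ℝ :=
  basisMatrix b * sigmaTheta b p * (basisMatrix b)ᵀ

/-- The multinomial covariance matrix `diag(p) - p pᵀ`. -/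
def multinomialCov {d : ℕ} {r : Fin d → ℕ} (p : RArray r) : Matrix (Cell r) (Cell r) ℝ :=
  Matrix.diagonal p - Matrix.vecMulVec p p

/-- The point of `ℝ^d` attached to a cell, when the `l`-th variable takes the values
`x l 1 < ⋯ < x l (r l)`. -/
def gridPoint {d : ℕ} {r : Fin d → ℕ} (x : (l : Fin d) → Fin (r l) → ℝ) (i : Cell r) :
    Fin d → ℝ := fun l => x l (i l)

/-- The probability array of a distribution `P` on the grid. -/
def probArray {d : ℕ} {r : Fin d → ℕ} (x : (l : Fin d) → Fin (r l) → ℝ)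
    (P : Measure (Fin d → ℝ)) : RArray r := fun i => P.real {gridPoint x i}

/-- The empirical probability array of the first `n` observations of the sample `X`. -/
def empArray {d : ℕ} {r : Fin d → ℕ} (x : (l : Fin d) → Fin (r l) → ℝ) {Ω : Type*}
    (X : ℕ → Ω → Fin d → ℝ) (n : ℕ) (ω : Ω) : RArray r := fun i =>
  (1 / (n : ℝ)) * ∑ k ∈ Finset.range n, Set.indicator {gridPoint x i} (fun _ => (1 : ℝ)) (X k ω)

/-- The uniform probability array on `S`. -/
def unifArray {d : ℕ} {r : Fin d → ℕ} (S : Finset (Cell r)) : RArray r := fun i =>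
  if i ∈ S then 1 / (S.card : ℝ) else 0

/-- The smoothed empirical probability array of the first `n` observations, for the known
support `S`. -/
def smoothedArray {d : ℕ} {r : Fin d → ℕ} (x : (l : Fin d) → Fin (r l) → ℝ)
    (S : Finset (Cell r)) {Ω : Type*} (X : ℕ → Ω → Fin d → ℝ) (n : ℕ) (ω : Ω) : RArray r :=
  ((n : ℝ) / ((n : ℝ) + 1)) • empArray x X n ω + (1 / ((n : ℝ) + 1)) • unifArray S

/-- The empirical copula array of the first `n` observations. -/
def empCopulaArray {d : ℕ} {r : Fin d → ℕ} (x : (l : Fin d) → Fin (r l) → ℝ)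
    (S : Finset (Cell r)) {Ω : Type*} (X : ℕ → Ω → Fin d → ℝ) (n : ℕ) (ω : Ω) : RArray r :=
  copulaArray (smoothedArray x S X n ω)

end

/-! ### Supports, margins and the minimisation problem behind the copula array. -/

section Arrays

variable {d : ℕ} {r : Fin d → ℕ}

/-! On the compact convex set of copula arrays supported in `S`, the `I`-divergence from an array
with support `S` is real, continuous and strictly convex, so it has exactly one minimiser;
compactness and uniqueness make this minimiser continuous in the projected array.

Some copula array has support exactly `S`, and `t log t` has slope `-∞` at `0`, so the minimiser is
positive on all of `S`. Small moves in both directions of the null-margin space are then admissible,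
and stationarity says that `log γ_q - log q` is orthogonal to that space. With `γ_q = γ_p + A θ`
this reads `Ãᵀ log R(γ_p + A θ) = Ãᵀ log R q`. The left side has derivative `Ãᵀ diag⁻¹(R γ_p) Ã` at
`θ = 0`, which is positive definite, so the inverse function theorem and the continuity already
known express `θ` as a local inverse applied to `Ãᵀ log R q`. The chain rule gives the Jacobian
(`hasFDerivWithinAt_copulaMap`).

Almost surely every observation falls in a cell of the support, and smoothing fills every such cell,
so the smoothed array always lies where the copula map is controlled. Consistency is then
continuity, (b) is a delta method within that set, and (c) adds the multinomial central limit
theorem. The sandwich form of the covariance comes from `J p = 0`, which removes the rank-one term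
`p pᵀ`. -/

lemma mem_supp {a : RArray r} {i : Cell r} : i ∈ supp a ↔ a i ≠ 0 := by simp [supp]

lemma supp_subset_iff {a : RArray r} {S : Finset (Cell r)} :
    supp a ⊆ S ↔ ∀ i, i ∉ S → a i = 0 := by
  refine forall_congr' fun i => ?_
  rw [mem_supp]
  tauto

lemma sum_margin (a : RArray r) (l : Fin d) : ∑ i, margin a l i = ∑ j, a j :=
  Finset.sum_fiberwise Finset.univ (fun j : Cell r => j l) a

lemma margin_add_smul (a b : RArray r) (s t : ℝ) (l : Fin d) (i : Fin (r l)) :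
    margin (s • a + t • b) l i = s * margin a l i + t * margin b l i := by
  simp [margin, Finset.sum_add_distrib, Finset.mul_sum]

lemma continuous_margin (l : Fin d) (i : Fin (r l)) :
    Continuous fun a : RArray r => margin a l i := by
  unfold margin
  fun_prop

/-- The total is the sum of any one margin; with `d = 0` there would be no margin to use. -/
lemma sum_eq_zero_of_mem_nullMarginSpace (hd : 1 ≤ d) {S : Finset (Cell r)} {a : RArray r}
    (ha : a ∈ nullMarginSpace S) : ∑ i, a i = 0 := by
  rw [← sum_margin a ⟨0, hd⟩]
  exact Finset.sum_eq_zero fun i _ => ha.2 _ i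

lemma le_one_of_sum_eq_one {a : RArray r} (h0 : ∀ i, 0 ≤ a i) (h1 : ∑ i, a i = 1) (i : Cell r) :
    a i ≤ 1 :=
  h1 ▸ Finset.single_le_sum (fun j _ => h0 j) (Finset.mem_univ i)

/-- The copula arrays with support included in `S`. -/
def copulaArraysIn (S : Finset (Cell r)) : Set (RArray r) :=
  {g | g ∈ copulaArrays r ∧ supp g ⊆ S}

lemma mem_copulaArraysIn {S : Finset (Cell r)} {g : RArray r} :
    g ∈ copulaArraysIn S ↔ (∀ i, 0 ≤ g i) ∧ ∑ i, g i = 1 ∧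
      (∀ l i, margin g l i = 1 / (r l : ℝ)) ∧ ∀ i, i ∉ S → g i = 0 := by
  constructor
  · rintro ⟨⟨⟨h1, h2, -⟩, h3⟩, h4⟩
    exact ⟨fun i => (h1 i).1, h2, h3, supp_subset_iff.1 h4⟩
  · rintro ⟨h1, h2, h3, h4⟩
    refine ⟨⟨⟨fun i => ⟨h1 i, le_one_of_sum_eq_one h1 h2 i⟩, h2, fun l i => ?_⟩, h3⟩,
      supp_subset_iff.2 h4⟩
    rw [h3]
    have : 0 < r l := i.pos
    positivity

lemma copulaArraysOn_subset_copulaArraysIn (S : Finset (Cell r)) :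
    copulaArraysOn S ⊆ copulaArraysIn S :=
  fun _ hg => ⟨hg.1, hg.2.le⟩

lemma isCompact_copulaArraysIn (S : Finset (Cell r)) : IsCompact (copulaArraysIn S) := by
  refine (isCompact_Icc (a := (0 : RArray r)) (b := 1)).of_isClosed_subset ?_ fun g hg => ?_
  · have : copulaArraysIn S = {g : RArray r | (∀ i, 0 ≤ g i) ∧ ∑ i, g i = 1 ∧
      (∀ l i, margin g l i = 1 / (r l : ℝ)) ∧ ∀ i, i ∉ S → g i = 0} :=
      Set.ext fun g => mem_copulaArraysIn
    rw [this]
    simp only [Set.ofPred_and, Set.ofPred_forall]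
    refine (isClosed_iInter fun i => isClosed_le continuous_const (continuous_apply i)).inter
      ((isClosed_eq (by fun_prop) continuous_const).inter
      ((isClosed_iInter fun l => isClosed_iInter fun i =>
        isClosed_eq (continuous_margin l i) continuous_const).inter
      (isClosed_iInter fun i => isClosed_iInter fun _ =>
        isClosed_eq (continuous_apply i) continuous_const)))
  · exact ⟨fun i => (hg.1.1.1 i).1, fun i => (hg.1.1.1 i).2⟩

lemma convex_copulaArraysIn (S : Finset (Cell r)) : Convex ℝ (copulaArraysIn S) := by
  intro g hg g' hg' s t hs ht hst
  rw [mem_copulaArraysIn] at *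
  obtain ⟨h1, h2, h3, h4⟩ := hg
  obtain ⟨k1, k2, k3, k4⟩ := hg'
  refine ⟨fun i => ?_, ?_, fun l i => ?_, fun i hi => ?_⟩
  · have := h1 i
    have := k1 i
    simp only [Pi.add_apply, Pi.smul_apply, smul_eq_mul]
    positivity
  · simp [Finset.sum_add_distrib, ← Finset.mul_sum, h2, k2, hst]
  · rw [margin_add_smul, h3, k3, ← add_mul, hst, one_mul]
  · simp [h4 i hi, k4 i hi]

/-- The `I`-divergence, as a real number, of an array supported in `S` with respect to an array
with support `S`. -/
noncomputable def divOn (S : Finset (Cell r)) (g q : RArray r) : ℝ :=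
  ∑ i ∈ S, (g i * Real.log (g i) - g i * Real.log (q i))

lemma pos_of_mem_probArraysOn {S : Finset (Cell r)} {q : RArray r} (hq : q ∈ probArraysOn S)
    {i : Cell r} (hi : i ∈ S) : 0 < q i :=
  lt_of_le_of_ne (hq.1.1 i).1 (Ne.symm (mem_supp.1 (hq.2 ▸ hi)))

lemma eq_zero_of_mem_probArraysOn {S : Finset (Cell r)} {q : RArray r} (hq : q ∈ probArraysOn S)
    {i : Cell r} (hi : i ∉ S) : q i = 0 := by
  by_contra h
  exact hi (hq.2 ▸ mem_supp.2 h)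

lemma iDiv_of_supp_subset {S : Finset (Cell r)} {g q : RArray r} (hq : q ∈ probArraysOn S)
    (hg : supp g ⊆ S) : iDiv g q = (divOn S g q : EReal) := by
  unfold iDiv
  rw [hq.2, if_pos hg]
  congr 1
  refine Finset.sum_congr rfl fun i hi => ?_
  by_cases h : g i = 0
  · simp [h]
  · rw [Real.log_div h (pos_of_mem_probArraysOn hq hi).ne', mul_sub]

lemma iDiv_of_not_supp_subset {S : Finset (Cell r)} {g q : RArray r} (hq : q ∈ probArraysOn S)
    (hg : ¬ supp g ⊆ S) : iDiv g q = ⊤ := by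
  unfold iDiv
  rw [hq.2, if_neg hg]

/-- A copula array supported in `S` is a competitor of finite divergence, so a projection cannot
charge a cell outside `S`. The extended-real problem thus becomes a real one on a compact convex
set. -/
lemma isIProjection_iff {S : Finset (Cell r)} {q g : RArray r} (hq : q ∈ probArraysOn S)
    (hne : (copulaArraysIn S).Nonempty) :
    IsIProjection (copulaArrays r) q g ↔
      g ∈ copulaArraysIn S ∧ IsMinOn (fun g => divOn S g q) (copulaArraysIn S) g := by
  constructor
  · rintro ⟨hg, h⟩
    have key : ∀ g' ∈ copulaArraysIn S, iDiv g q ≤ (divOn S g' q : EReal) := by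
      intro g' hg'
      rw [h, ← iDiv_of_supp_subset hq hg'.2]
      exact iInf₂_le g' hg'.1
    have hgS : supp g ⊆ S := by
      by_contra hgS
      obtain ⟨g', hg'⟩ := hne
      have := key g' hg'
      rw [iDiv_of_not_supp_subset hq hgS] at this
      exact absurd this (by simp)
    refine ⟨⟨hg, hgS⟩, fun g' hg' => ?_⟩
    have := key g' hg'
    rw [iDiv_of_supp_subset hq hgS] at this
    exact_mod_cast this
  · rintro ⟨hg, h⟩
    refine ⟨hg.1, le_antisymm (le_iInf₂ fun g' hg' => ?_) (iInf₂_le g hg.1)⟩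
    by_cases hgS : supp g' ⊆ S
    · rw [iDiv_of_supp_subset hq hgS, iDiv_of_supp_subset hq hg.2]
      exact_mod_cast h ⟨hg', hgS⟩
    · rw [iDiv_of_not_supp_subset hq hgS]
      exact le_top

/-- The `log q` part is linear and `x log x` is strictly convex; two distinct arrays vanishing off
`S` must differ at a cell of `S`, where the strict inequality occurs. -/
lemma strictConvexOn_divOn (S : Finset (Cell r)) (q : RArray r) :
    StrictConvexOn ℝ (copulaArraysIn S) fun g => divOn S g q := by
  refine ⟨convex_copulaArraysIn S, fun g hg g' hg' hne s t hs ht hst => ?_⟩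
  rw [mem_copulaArraysIn] at hg hg'
  obtain ⟨j, hj⟩ := Function.ne_iff.1 hne
  have hjS : j ∈ S := by
    by_contra h
    exact hj (by rw [hg.2.2.2 j h, hg'.2.2.2 j h])
  simp only [divOn, smul_eq_mul, Finset.mul_sum, ← Finset.sum_add_distrib]
  refine Finset.sum_lt_sum (fun i _ => ?_) ⟨j, hjS, ?_⟩
  · have := Real.convexOn_mul_log.2 (hg.1 i) (hg'.1 i) hs.le ht.le hst
    simp only [smul_eq_mul] at this
    simp only [Pi.add_apply, Pi.smul_apply, smul_eq_mul]
    linarith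
  · have := Real.strictConvexOn_mul_log.2 (hg.1 j) (hg'.1 j) hj hs ht hst
    simp only [smul_eq_mul] at this
    simp only [Pi.add_apply, Pi.smul_apply, smul_eq_mul]
    linarith

lemma existsUnique_isIProjection {S : Finset (Cell r)} {q : RArray r} (hq : q ∈ probArraysOn S)
    (hne : (copulaArraysIn S).Nonempty) : ∃! g, IsIProjection (copulaArrays r) q g := by
  simp only [isIProjection_iff hq hne]
  have hc : ContinuousOn (fun g => divOn S g q) (copulaArraysIn S) := by
    refine (continuous_finsetSum _ fun i _ => ?_).continuousOn
    exact (Real.continuous_mul_log.comp (continuous_apply i)).sub (by fun_prop)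
  obtain ⟨g, hg, hmin⟩ := (isCompact_copulaArraysIn S).exists_isMinOn hne hc
  exact ⟨g, ⟨hg, hmin⟩, fun g' hg' => (strictConvexOn_divOn S q).eq_of_isMinOn hg'.2 hmin hg'.1 hg⟩

lemma copulaArray_spec {S : Finset (Cell r)} {q : RArray r} (hq : q ∈ probArraysOn S)
    (hne : (copulaArraysIn S).Nonempty) :
    copulaArray q ∈ copulaArraysIn S ∧
      IsMinOn (fun g => divOn S g q) (copulaArraysIn S) (copulaArray q) := by
  have h := (existsUnique_isIProjection hq hne).exists
  rw [← isIProjection_iff hq hne, copulaArray, dif_pos h]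
  exact h.choose_spec

/-- A cluster point of the minimisers as `q → p` is again a minimiser for `p`: the divergence is
jointly continuous there because `p` is positive on `S`. Uniqueness identifies it, and compactness
turns this into convergence. -/
lemma continuousOn_copulaArray {S : Finset (Cell r)} (hne : (copulaArraysIn S).Nonempty) :
    ContinuousOn (copulaArray (r := r)) (probArraysOn S) := by
  intro p hp
  refine (isCompact_copulaArraysIn S).tendsto_nhds_of_unique_mapClusterPt
    (eventually_nhdsWithin_of_forall fun q hq => (copulaArray_spec hq hne).1) fun g hg hcl => ?_
  obtain ⟨U, hU, hUg⟩ := mapClusterPt_iff_ultrafilter.1 hcl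
  have hUp : Tendsto (fun q : RArray r => q) U (𝓝 p) := hU.trans nhdsWithin_le_nhds
  have hUS : ∀ᶠ q in (U : Filter (RArray r)), q ∈ probArraysOn S := hU self_mem_nhdsWithin
  have hF : ∀ (u : RArray r → RArray r) (h : RArray r), Tendsto u U (𝓝 h) →
      Tendsto (fun q => divOn S (u q) q) U (𝓝 (divOn S h p)) := by
    intro u h hu
    refine tendsto_finsetSum _ fun i hi => ?_
    have hui := (tendsto_pi_nhds.1 hu) i
    exact ((Real.continuous_mul_log.tendsto _).comp hui).sub
      (hui.mul (((tendsto_pi_nhds.1 hUp) i).log (pos_of_mem_probArraysOn hp hi).ne'))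
  refine (strictConvexOn_divOn S p).eq_of_isMinOn (fun h hh => ?_) (copulaArray_spec hp hne).2 hg
    (copulaArray_spec hp hne).1
  refine le_of_tendsto_of_tendsto (hF _ _ hUg) (hF (fun _ => h) h tendsto_const_nhds) ?_
  filter_upwards [hUS] with q hq using (copulaArray_spec hq hne).2 hh

/-! ### Positivity of the minimiser and its first-order condition. -/

/-- If the minimiser `g` vanished at `j`, moving by `t` towards a copula array `h` with full support
would change the divergence by at most a term linear in `t` plus `h j * t log t`, a decrease for
small `t`. -/
lemma copulaArray_pos {S : Finset (Cell r)} {q : RArray r} (hq : q ∈ probArraysOn S)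
    (hne : (copulaArraysOn S).Nonempty) {j : Cell r} (hj : j ∈ S) : 0 < copulaArray q j := by
  obtain ⟨h, hh⟩ := hne
  have hhK := copulaArraysOn_subset_copulaArraysIn S hh
  obtain ⟨hg, hmin⟩ := copulaArray_spec hq ⟨h, hhK⟩
  set g := copulaArray q
  have hg' := mem_copulaArraysIn.1 hg
  have hh' := mem_copulaArraysIn.1 hhK
  refine lt_of_le_of_ne (hg'.1 j) fun h0 => ?_
  have hjpos : 0 < h j := lt_of_le_of_ne (hh'.1 j) (Ne.symm (mem_supp.1 (hh.2 ▸ hj)))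
  have key : ∀ t : ℝ, 0 < t → t < 1 → divOn S g q - divOn S h q ≤ h j * Real.log t := by
    intro t ht0 ht1
    have hm := hmin (convex_copulaArraysIn S hg hhK (sub_nonneg.2 ht1.le) ht0.le
      (sub_add_cancel 1 t))
    have hle : divOn S ((1 - t) • g + t • h) q ≤
        (1 - t) * divOn S g q + t * divOn S h q + t * (h j * Real.log t) := by
      -- Only the cell `j` produces the logarithmic term; writing it as a sum over `S` reduces the
      -- bound to a cellwise comparison, by convexity at the other cells.
      have : t * (h j * Real.log t) = ∑ i ∈ S, if i = j then t * (h j * Real.log t) else 0 := by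
        simp [hj]
      rw [this]
      simp only [divOn, Finset.mul_sum, ← Finset.sum_add_distrib]
      refine Finset.sum_le_sum fun i _ => ?_
      simp only [Pi.add_apply, Pi.smul_apply, smul_eq_mul]
      split_ifs with hij
      · subst hij
        rw [← h0, mul_zero, zero_add, Real.log_mul ht0.ne' hjpos.ne']
        apply le_of_eq
        ring
      · have := Real.convexOn_mul_log.2 (hg'.1 i) (hh'.1 i) (sub_nonneg.2 ht1.le) ht0.le
          (sub_add_cancel 1 t)
        simp only [smul_eq_mul] at this
        linarith
    have h2 : divOn S g q ≤ divOn S ((1 - t) • g + t • h) q := hm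
    have h3 : t * (divOn S g q - divOn S h q) ≤ t * (h j * Real.log t) := by linarith
    exact le_of_mul_le_mul_left h3 ht0
  -- At `t = exp (-c)` the bound is `-(|D| + 1)`, where `D` is the difference of divergences; this
  -- is below `D`, a contradiction.
  set c := (|divOn S g q - divOn S h q| + 1) / h j
  have hc : 0 < c := by positivity
  have h1 := key (Real.exp (-c)) (Real.exp_pos _) (by simpa using hc)
  rw [Real.log_exp, mul_neg, mul_div_cancel₀ _ hjpos.ne'] at h1
  have := neg_abs_le (divOn S g q - divOn S h q)
  linarith

/-- Positivity on `S` keeps `g + t • a` a copula array for small `t` of either sign, so the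
derivative in `t` vanishes at `0`. The constant `1` in the derivative of `x log x` drops out because
`a` sums to zero. -/
lemma sum_mul_log_copulaArray (hd : 1 ≤ d) {S : Finset (Cell r)} {q : RArray r}
    (hq : q ∈ probArraysOn S) (hne : (copulaArraysOn S).Nonempty) {a : RArray r}
    (ha : a ∈ nullMarginSpace S) :
    ∑ i ∈ S, a i * Real.log (copulaArray q i) = ∑ i ∈ S, a i * Real.log (q i) := by
  obtain ⟨hg, hmin⟩ := copulaArray_spec hq (hne.mono (copulaArraysOn_subset_copulaArraysIn S))
  have hpos : ∀ i ∈ S, 0 < copulaArray q i := fun i hi => copulaArray_pos hq hne hi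
  set g := copulaArray q
  have hg' := mem_copulaArraysIn.1 hg
  have ha0 : ∀ i, i ∉ S → a i = 0 := supp_subset_iff.1 ha.1
  have hnn : ∀ᶠ t : ℝ in 𝓝 0, ∀ i, 0 ≤ g i + t * a i := by
    refine eventually_all.2 fun i => ?_
    by_cases hi : i ∈ S
    · have : Tendsto (fun t : ℝ => g i + t * a i) (𝓝 0) (𝓝 (g i)) := by
        have : Continuous fun t : ℝ => g i + t * a i := by fun_prop
        simpa using this.tendsto 0
      filter_upwards [this.eventually (lt_mem_nhds (hpos i hi))] with t ht using ht.le
    · simp [ha0 i hi, hg'.1 i]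
  have hloc : IsLocalMin (fun t : ℝ => divOn S (g + t • a) q) 0 := by
    filter_upwards [hnn] with t ht
    simp only [zero_smul, add_zero]
    refine hmin (mem_copulaArraysIn.2 ⟨ht, ?_, fun l i => ?_, fun i hi => ?_⟩)
    · simp [Finset.sum_add_distrib, ← Finset.mul_sum, hg'.2.1,
        sum_eq_zero_of_mem_nullMarginSpace hd ha]
    · have := margin_add_smul g a 1 t l i
      rw [one_smul] at this
      rw [this, ha.2, hg'.2.2.1]
      ring
    · simp [ha0 i hi, hg'.2.2.2 i hi]
  have hder : HasDerivAt (fun t : ℝ => divOn S (g + t • a) q)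
      (∑ i ∈ S, ((Real.log (g i) + 1) * a i - a i * Real.log (q i))) 0 := by
    refine HasDerivAt.fun_sum fun i hi => ?_
    have h1 : HasDerivAt (fun t : ℝ => (g + t • a) i) (a i) 0 := by
      simpa using ((hasDerivAt_id (0 : ℝ)).mul_const (a i)).const_add (g i)
    have h2 := (Real.hasDerivAt_mul_log (x := (g + (0 : ℝ) • a) i)
      (by simpa using (hpos i hi).ne')).comp (0 : ℝ) h1
    simp only [zero_smul, add_zero] at h2
    exact h2.sub (h1.mul_const _)
  have h0 := hloc.hasDerivAt_eq_zero hder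
  have hs : ∑ i ∈ S, a i = 0 := by
    rw [Finset.sum_subset (Finset.subset_univ S) fun i _ hi => ha0 i hi]
    exact sum_eq_zero_of_mem_nullMarginSpace hd ha
  have h3 : ∑ i ∈ S, ((Real.log (g i) + 1) * a i - a i * Real.log (q i)) =
      ∑ i ∈ S, a i * Real.log (g i) + ∑ i ∈ S, a i - ∑ i ∈ S, a i * Real.log (q i) := by
    rw [← Finset.sum_add_distrib, ← Finset.sum_sub_distrib]
    exact Finset.sum_congr rfl fun i _ => by ring
  linarith

lemma copulaArray_sub_mem_nullMarginSpace {S : Finset (Cell r)} {p q : RArray r}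
    (hp : p ∈ probArraysOn S) (hq : q ∈ probArraysOn S) (hne : (copulaArraysIn S).Nonempty) :
    copulaArray q - copulaArray p ∈ nullMarginSpace S := by
  have hp' := mem_copulaArraysIn.1 (copulaArray_spec hp hne).1
  have hq' := mem_copulaArraysIn.1 (copulaArray_spec hq hne).1
  refine ⟨supp_subset_iff.2 fun i hi => ?_, fun l i => ?_⟩
  · simp [hp'.2.2.2 i hi, hq'.2.2.2 i hi]
  · have h := margin_add_smul (copulaArray q) (copulaArray p) 1 (-1) l i
    rw [one_smul, neg_one_smul, ← sub_eq_add_neg] at h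
    rw [h, hp'.2.2.1, hq'.2.2.1]
    ring

end Arrays

/-! ### The Jacobian by the inverse function theorem. -/

section Jacobian

open scoped Matrix

variable {d : ℕ} {r : Fin d → ℕ} {S : Finset (Cell r)} {k : ℕ}

lemma selMatrix_mulVec (v : RArray r) : selMatrix S *ᵥ v = fun i : S => v i := by
  ext i
  simp [selMatrix, Matrix.mulVec, dotProduct, Matrix.one_apply]

lemma redMatrix_apply (b : Module.Basis (Fin k) ℝ (nullMarginSpace S)) (i : S) (m : Fin k) :
    redMatrix b i m = (b m : RArray r) i := by
  simp [redMatrix, selMatrix, basisMatrix, Matrix.mul_apply, Matrix.one_apply]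

lemma basisMatrix_mulVec (b : Module.Basis (Fin k) ℝ (nullMarginSpace S)) (θ : Fin k → ℝ) :
    basisMatrix b *ᵥ θ = ((b.equivFun.symm θ : nullMarginSpace S) : RArray r) := by
  ext i
  simp [basisMatrix, Matrix.mulVec, dotProduct, mul_comm]

lemma redMatrix_mulVec (b : Module.Basis (Fin k) ℝ (nullMarginSpace S)) (θ : Fin k → ℝ) :
    redMatrix b *ᵥ θ = fun i : S => (basisMatrix b *ᵥ θ) i := by
  rw [redMatrix, ← Matrix.mulVec_mulVec, selMatrix_mulVec]

/-- Dropping the rows outside `S` loses nothing, since null-margin arrays vanish there; this makes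
the information matrix definite. -/
lemma redMatrix_mulVec_injective (b : Module.Basis (Fin k) ℝ (nullMarginSpace S)) :
    Function.Injective (redMatrix b).mulVec := by
  intro θ θ' h
  simp only [redMatrix_mulVec, basisMatrix_mulVec] at h
  refine b.equivFun.symm.injective (Subtype.ext (funext fun i => ?_))
  by_cases hi : i ∈ S
  · exact congrFun h ⟨i, hi⟩
  · rw [supp_subset_iff.1 (b.equivFun.symm θ).2.1 i hi,
      supp_subset_iff.1 (b.equivFun.symm θ').2.1 i hi]

lemma posDef_infoMatrix (b : Module.Basis (Fin k) ℝ (nullMarginSpace S)) {v : RArray r}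
    (hv : ∀ i ∈ S, 0 < v i) : (infoMatrix b v).PosDef := by
  have h : (diagInv (selMatrix S *ᵥ v)).PosDef := by
    rw [selMatrix_mulVec]
    exact Matrix.PosDef.diagonal fun i => inv_pos.2 (hv i i.2)
  simpa [infoMatrix] using h.conjTranspose_mul_mul_same (redMatrix_mulVec_injective b)

lemma transpose_mul_diagInv_mulVec (b : Module.Basis (Fin k) ℝ (nullMarginSpace S))
    (v w : RArray r) (m : Fin k) :
    (((redMatrix b)ᵀ * diagInv (selMatrix S *ᵥ v) * selMatrix S) *ᵥ w) m =
      ∑ i : S, (b m : RArray r) i * ((v i)⁻¹ * w i) := by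
  rw [← Matrix.mulVec_mulVec, ← Matrix.mulVec_mulVec, selMatrix_mulVec, selMatrix_mulVec]
  simp [Matrix.mulVec, dotProduct, diagInv, redMatrix_apply, Matrix.diagonal_apply]

/-- The coordinates of an array of `nullMarginSpace S` in the basis `b`. -/
lemma infoMatrix_inv_mulVec_eq (b : Module.Basis (Fin k) ℝ (nullMarginSpace S)) {v : RArray r}
    (hv : ∀ i ∈ S, 0 < v i) (a : nullMarginSpace S) :
    ((infoMatrix b v)⁻¹ * ((redMatrix b)ᵀ * diagInv (selMatrix S *ᵥ v) * selMatrix S)) *ᵥ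
      (a : RArray r) = b.equivFun a := by
  have ha : (a : RArray r) = basisMatrix b *ᵥ b.equivFun a := by
    rw [basisMatrix_mulVec, LinearEquiv.symm_apply_apply]
  have hM : (redMatrix b)ᵀ * diagInv (selMatrix S *ᵥ v) * selMatrix S * basisMatrix b =
      infoMatrix b v := by
    rw [Matrix.mul_assoc _ (selMatrix S)]
    rfl
  rw [ha, Matrix.mulVec_mulVec, Matrix.mul_assoc, hM,
    Matrix.nonsing_inv_mul _ ((Matrix.isUnit_iff_isUnit_det _).1 (posDef_infoMatrix b hv).isUnit),
    Matrix.one_mulVec]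

/-- The logarithmic score `Ãᵀ log (R (g + A θ))`. -/
noncomputable def logScore (b : Module.Basis (Fin k) ℝ (nullMarginSpace S)) (g : RArray r)
    (θ : Fin k → ℝ) : Fin k → ℝ := fun m =>
  ∑ i : S, (b m : RArray r) i * Real.log (g i + ∑ m', (b m' : RArray r) i * θ m')

/-- Differentiating `log` at `g i` produces the weight `(g i)⁻¹`, hence the information matrix.
Strictness is what the inverse function theorem requires. -/
lemma hasStrictFDerivAt_logScore (b : Module.Basis (Fin k) ℝ (nullMarginSpace S)) {g : RArray r}
    (hg : ∀ i ∈ S, 0 < g i) :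
    HasStrictFDerivAt (logScore b g) (LinearMap.toContinuousLinearMap (infoMatrix b g).mulVecLin)
      0 := by
  rw [hasStrictFDerivAt_pi']
  intro m
  have h1 : ∀ i : S, HasStrictFDerivAt
      (fun θ : Fin k → ℝ => g i + ∑ m', (b m' : RArray r) i * θ m')
      (∑ m', (b m' : RArray r) i • ContinuousLinearMap.proj (R := ℝ) (φ := fun _ => ℝ) m') 0 :=
    fun i => (HasStrictFDerivAt.fun_sum fun m' _ =>
      (hasStrictFDerivAt_apply m' (0 : Fin k → ℝ)).const_mul _).const_add _
  have h2 := HasStrictFDerivAt.fun_sum (u := Finset.univ) fun (i : S) _ =>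
    ((h1 i).log (by simpa using (hg i i.2).ne')).const_mul ((b m : RArray r) i)
  refine h2.congr_fderiv ?_
  ext θ
  have hM : (infoMatrix b g *ᵥ θ) m =
      (((redMatrix b)ᵀ * diagInv (selMatrix S *ᵥ g) * selMatrix S) *ᵥ (basisMatrix b *ᵥ θ)) m := by
    rw [Matrix.mulVec_mulVec, Matrix.mul_assoc _ (selMatrix S)]
    rfl
  simp only [ContinuousLinearMap.coe_comp, Function.comp_apply, ContinuousLinearMap.proj_apply,
    LinearMap.coe_toContinuousLinearMap', Matrix.mulVecLin_apply]
  rw [hM, transpose_mul_diagInv_mulVec]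
  simp [basisMatrix, Matrix.mulVec, dotProduct]

lemma hasFDerivAt_sum_mul_log (b : Module.Basis (Fin k) ℝ (nullMarginSpace S)) {p : RArray r}
    (hp : ∀ i ∈ S, 0 < p i) :
    HasFDerivAt
      (fun (v : VecSpace r) (m : Fin k) => ∑ i : S, (b m : RArray r) i * Real.log (v i))
      ((LinearMap.toContinuousLinearMap
        ((redMatrix b)ᵀ * diagInv (selMatrix S *ᵥ p) * selMatrix S).mulVecLin).comp
        (EuclideanSpace.equiv (Cell r) ℝ).toContinuousLinearMap) (vec p) := by
  rw [hasFDerivAt_pi']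
  intro m
  have h2 := HasFDerivAt.fun_sum (u := Finset.univ) fun (i : S) _ =>
    ((EuclideanSpace.proj (𝕜 := ℝ) (i : Cell r)).hasFDerivAt (x := vec p) |>.log
      (by simpa [vec] using (hp i i.2).ne')).const_mul ((b m : RArray r) i)
  refine h2.congr_fderiv ?_
  ext1 w
  have := transpose_mul_diagInv_mulVec b p (WithLp.ofLp w) m
  simp only [ContinuousLinearMap.coe_comp, Function.comp_apply, ContinuousLinearMap.proj_apply,
    LinearMap.coe_toContinuousLinearMap', Matrix.mulVecLin_apply]
  refine Eq.trans ?_ this.symm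
  simp [vec]

lemma toEuclideanCLM_apply_ofLp {ι : Type*} [Fintype ι] [DecidableEq ι] (M : Matrix ι ι ℝ)
    (w : EuclideanSpace ℝ ι) :
    Matrix.toEuclideanCLM (𝕜 := ℝ) M w = WithLp.toLp 2 (M *ᵥ WithLp.ofLp w) := by
  rfl

/-- The first-order condition makes the coordinates of `γ_q - γ_p` an implicit function of `q`;
continuity of the projection keeps them on the branch selected by the local inverse. -/
lemma hasFDerivWithinAt_copulaMap (hd : 1 ≤ d) {p : RArray r} (hp : p ∈ probArraysOn S)
    (hne : (copulaArraysOn S).Nonempty) (b : Module.Basis (Fin k) ℝ (nullMarginSpace S)) :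
    HasFDerivWithinAt copulaMap (Matrix.toEuclideanCLM (𝕜 := ℝ) (copulaJacobian b p))
      (vec '' probArraysOn S) (vec p) := by
  have hne' := hne.mono (copulaArraysOn_subset_copulaArraysIn S)
  set g := copulaArray p with hgdef
  have hg : ∀ i ∈ S, 0 < g i := fun i hi => copulaArray_pos hp hne hi
  have hp0 : ∀ i ∈ S, 0 < p i := fun i hi => pos_of_mem_probArraysOn hp hi
  have hu : IsUnit (infoMatrix b g).det :=
    (Matrix.isUnit_iff_isUnit_det _).1 (posDef_infoMatrix b hg).isUnit
  let e : (Fin k → ℝ) ≃L[ℝ] (Fin k → ℝ) :=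
    ContinuousLinearEquiv.equivOfInverse
      (LinearMap.toContinuousLinearMap (infoMatrix b g).mulVecLin)
      (LinearMap.toContinuousLinearMap (infoMatrix b g)⁻¹.mulVecLin)
      (fun θ => by simp [Matrix.nonsing_inv_mul _ hu])
      (fun θ => by simp [Matrix.mul_nonsing_inv _ hu])
  have he : HasStrictFDerivAt (logScore b g) (e : (Fin k → ℝ) →L[ℝ] (Fin k → ℝ)) 0 :=
    hasStrictFDerivAt_logScore b hg
  -- A weighted least-squares left inverse of `A`: it recovers the coordinates in the basis and,
  -- being linear on all arrays, inherits the continuity of the copula array.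
  let θ : VecSpace r → (Fin k → ℝ) := fun v =>
    ((infoMatrix b g)⁻¹ * ((redMatrix b)ᵀ * diagInv (selMatrix S *ᵥ g) * selMatrix S)) *ᵥ
      (copulaArray (unvec v) - g)
  have hθ : ∀ q ∈ probArraysOn S, basisMatrix b *ᵥ θ (vec q) = copulaArray q - g := by
    intro q hq
    have := infoMatrix_inv_mulVec_eq b hg ⟨_, copulaArray_sub_mem_nullMarginSpace hp hq hne'⟩
    change basisMatrix b *ᵥ (_ *ᵥ (copulaArray q - g)) = copulaArray q - g
    rw [this, basisMatrix_mulVec, LinearEquiv.symm_apply_apply]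
  have hθp : θ (vec p) = 0 := by
    change _ *ᵥ (copulaArray p - g) = 0
    rw [hgdef, sub_self, Matrix.mulVec_zero]
  have hcont : ContinuousWithinAt θ (vec '' probArraysOn S) (vec p) := by
    have h1 : ContinuousWithinAt (fun v : VecSpace r => copulaArray (unvec v))
        (vec '' probArraysOn S) (vec p) := by
      refine ContinuousWithinAt.comp (t := probArraysOn S) (continuousOn_copulaArray hne' p hp)
        (PiLp.continuous_ofLp 2 _).continuousWithinAt ?_
      rintro _ ⟨q, hq, rfl⟩
      exact hq
    exact ((LinearMap.continuous_of_finiteDimensional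
      (Matrix.mulVecLin ((infoMatrix b g)⁻¹ * ((redMatrix b)ᵀ * diagInv (selMatrix S *ᵥ g) *
        selMatrix S)))).continuousAt.comp_continuousWithinAt (h1.sub continuousWithinAt_const))
  let h : VecSpace r → (Fin k → ℝ) := fun v m => ∑ i : S, (b m : RArray r) i * Real.log (v i)
  have hscore : ∀ q ∈ probArraysOn S, logScore b g (θ (vec q)) = h (vec q) := by
    intro q hq
    ext m
    have h1 : ∀ i : Cell r, g i + ∑ m', (b m' : RArray r) i * θ (vec q) m' = copulaArray q i := by
      intro i
      have := congrFun (hθ q hq) i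
      simp only [basisMatrix, Matrix.mulVec, dotProduct, Matrix.of_apply, Pi.sub_apply] at this
      rw [this]
      ring
    simp only [logScore, h1, h]
    have := sum_mul_log_copulaArray hd hq hne (b m).2
    rw [← Finset.sum_coe_sort S, ← Finset.sum_coe_sort S] at this
    exact this
  -- Continuity and `θ (vec p) = 0` bring `θ v` into the neighbourhood where the local inverse
  -- undoes the score.
  have hinv : ∀ᶠ v in 𝓝[vec '' probArraysOn S] (vec p),
      θ v = he.localInverse (logScore b g) e 0 (h v) := by
    have h1 := hcont.eventually (by rw [hθp]; exact he.eventually_left_inverse)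
    filter_upwards [h1, self_mem_nhdsWithin] with v hv hvS
    obtain ⟨q, hq, rfl⟩ := hvS
    rw [← hscore q hq, hv]
  have hh0 : h (vec p) = logScore b g 0 := by rw [← hscore p hp, hθp]
  have hinv' : HasFDerivAt (he.localInverse (logScore b g) e 0)
      (e.symm : (Fin k → ℝ) →L[ℝ] (Fin k → ℝ)) (h (vec p)) := by
    rw [hh0]
    exact he.to_localInverse.hasFDerivAt
  have hder := ((hinv'.comp (vec p)
    (hasFDerivAt_sum_mul_log b hp0)).hasFDerivWithinAt).congr_of_eventuallyEq hinv
      (hinv.self_of_nhdsWithin ⟨p, hp, rfl⟩)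
  have hA := ((EuclideanSpace.equiv (Cell r) ℝ).symm.toContinuousLinearMap.comp
    (LinearMap.toContinuousLinearMap (basisMatrix b).mulVecLin)).hasFDerivAt.comp_hasFDerivWithinAt
      (vec p) hder
  refine ((hA.const_add (vec g)).congr_fderiv ?_).congr' ?_ ⟨p, hp, rfl⟩
  · ext1 w
    simp only [ContinuousLinearMap.coe_comp, Function.comp_apply, toEuclideanCLM_apply_ofLp,
      copulaJacobian]
    change WithLp.toLp 2 (basisMatrix b *ᵥ ((infoMatrix b g)⁻¹ *ᵥ
      (((redMatrix b)ᵀ * diagInv (selMatrix S *ᵥ p) * selMatrix S) *ᵥ WithLp.ofLp w))) = _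
    simp only [Matrix.mulVec_mulVec, Matrix.mul_assoc, ← hgdef]
  · rintro _ ⟨q, hq, rfl⟩
    change WithLp.toLp 2 (copulaArray q) =
      WithLp.toLp 2 g + WithLp.toLp 2 (basisMatrix b *ᵥ θ (vec q))
    rw [hθ q hq, ← WithLp.toLp_add, add_sub_cancel]

end Jacobian

/-! ### Convergence in probability and in law, and the delta method. -/

section ConvergenceLemmas

/-- Needed because continuity of the copula map is known only on the arrays with the given support:
the law of `q` is carried by `s`. -/
lemma ContinuousOn.aemeasurable_comp {Ω E F : Type*} [MeasurableSpace Ω] {μ : Measure Ω}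
    [TopologicalSpace E] [MeasurableSpace E]
    [BorelSpace E] [TopologicalSpace F] [MeasurableSpace F] [BorelSpace F]
    {q : Ω → E} {φ : E → F} {s : Set E} (hφ : ContinuousOn φ s) (hs : MeasurableSet s)
    (hq : AEMeasurable q μ) (hqs : ∀ᵐ ω ∂μ, q ω ∈ s) : AEMeasurable (fun ω => φ (q ω)) μ := by
  have h := hφ.aemeasurable (μ := μ.map q) hs
  rw [Measure.restrict_eq_self_of_ae_mem ((ae_map_iff hq hs).2 hqs)] at h
  exact h.comp_aemeasurable hq

/-- Convergence in probability is preserved by a map which is continuous at the limit within a set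
containing the sequence almost surely. -/
lemma MeasureTheory.TendstoInMeasure.comp_continuousWithinAt {Ω E F : Type*} [MeasurableSpace Ω]
    {μ : Measure Ω} [PseudoEMetricSpace E]
    [PseudoEMetricSpace F] {q : ℕ → Ω → E} {φ : E → F} {s : Set E} {a : E}
    (hq : TendstoInMeasure μ q atTop fun _ => a) (hs : ∀ n, ∀ᵐ ω ∂μ, q n ω ∈ s)
    (hφ : ContinuousWithinAt φ s a) :
    TendstoInMeasure μ (fun n ω => φ (q n ω)) atTop fun _ => φ a := by
  intro ε hε
  obtain ⟨δ, hδ, h⟩ := (Metric.nhdsWithin_basis_eball.tendsto_iff Metric.nhds_basis_eball).1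
    hφ ε hε
  refine tendsto_of_tendsto_of_tendsto_of_le_of_le tendsto_const_nhds (hq δ hδ)
    (fun _ => zero_le) fun n => measure_mono_ae ?_
  filter_upwards [hs n] with ω hω hle
  by_contra hlt
  exact absurd (h _ ⟨not_le.1 hlt, hω⟩) (not_lt.2 hle)

lemma tendstoInMeasure_const_of_tendsto {Ω E : Type*} [MeasurableSpace Ω]
    {μ : Measure Ω} [PseudoEMetricSpace E] {u : ℕ → E}
    {c : E} (h : Tendsto u atTop (𝓝 c)) :
    TendstoInMeasure μ (fun n _ => u n) atTop fun _ => c := by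
  intro ε hε
  refine tendsto_const_nhds.congr' ?_
  have : ∀ᶠ n in atTop, edist (u n) c < ε := (tendsto_iff_edist_tendsto_0.1 h).eventually_lt_const hε
  filter_upwards [this] with n hn
  exact (measure_mono_null (fun ω hω => (not_le.2 hn hω).elim) measure_empty).symm

variable {Ω Ω' : Type*} [MeasurableSpace Ω] {μ : Measure Ω} [IsProbabilityMeasure μ]
  [MeasurableSpace Ω'] {ν : Measure Ω'} [IsProbabilityMeasure ν]

/-- Convergence in law to a constant implies convergence in probability. -/
lemma MeasureTheory.TendstoInDistribution.tendstoInMeasure_of_const {E : Type*}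
    [PseudoEMetricSpace E] [MeasurableSpace E] [BorelSpace E]
    {Y : ℕ → Ω → E} {c : E}
    (h : TendstoInDistribution Y atTop (fun _ : Ω' => c) (fun _ => μ) ν) :
    TendstoInMeasure μ Y atTop fun _ => c := by
  intro ε hε
  have hF : IsClosed {y : E | ε ≤ edist y c} :=
    isClosed_le continuous_const (continuous_id.edist continuous_const)
  have hlim := ProbabilityMeasure.limsup_measure_closed_le_of_tendsto h.tendsto hF
  have h0 : (ν.map fun _ : Ω' => c) {y : E | ε ≤ edist y c} = 0 := by
    rw [Measure.map_apply measurable_const hF.measurableSet]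
    simp [hε.ne']
  have hY : ∀ n, (μ.map (Y n)) {y : E | ε ≤ edist y c} = μ {ω | ε ≤ edist (Y n ω) c} := fun n =>
    Measure.map_apply_of_aemeasurable (h.forall_aemeasurable n) hF.measurableSet
  simp only [ProbabilityMeasure.coe_mk, h0, hY] at hlim
  exact tendsto_of_le_liminf_of_limsup_le zero_le hlim

lemma MeasureTheory.TendstoInDistribution.of_map_eq {Ω'' E : Type*} [MeasurableSpace Ω'']
    {ν' : Measure Ω''} [IsProbabilityMeasure ν'] [TopologicalSpace E] [MeasurableSpace E]
    [OpensMeasurableSpace E] {Y : ℕ → Ω → E} {Z : Ω' → E} {Z' : Ω'' → E}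
    (h : TendstoInDistribution Y atTop Z (fun _ => μ) ν) (hZ' : AEMeasurable Z' ν')
    (heq : ν.map Z = ν'.map Z') : TendstoInDistribution Y atTop Z' (fun _ => μ) ν' where
  forall_aemeasurable := h.forall_aemeasurable
  aemeasurable_limit := hZ'
  tendsto := by
    have := h.tendsto
    simpa only [heq] using this

variable {E F : Type*} [NormedAddCommGroup E] [NormedSpace ℝ E] [MeasurableSpace E] [BorelSpace E]
  [SecondCountableTopology E]
  [NormedAddCommGroup F] [NormedSpace ℝ F] [MeasurableSpace F] [BorelSpace F]
  [SecondCountableTopology F]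

/-- If `ρ n (q n - a)` converges in law and `ρ n → ∞`, then `q n → a` in probability. -/
lemma MeasureTheory.TendstoInDistribution.tendstoInMeasure_of_smul_sub {ρ : ℕ → ℝ}
    (hρ : Tendsto ρ atTop atTop) {q : ℕ → Ω → E} {a : E} {Z : Ω' → E}
    (h : TendstoInDistribution (fun n ω => ρ n • (q n ω - a)) atTop Z (fun _ => μ) ν) :
    TendstoInMeasure μ q atTop fun _ => a := by
  -- Slutsky's lemma for `q n = a + (ρ n)⁻¹ • (ρ n • (q n - a))`, valid once `ρ n > 0`, with `(ρ
  -- n)⁻¹ → 0`.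
  have h1 := h.continuous_comp_prodMk_of_tendstoInMeasure_const
    (g := fun x : E × ℝ => a + x.2 • x.1) (by fun_prop)
    (tendstoInMeasure_const_of_tendsto (tendsto_inv_atTop_zero.comp hρ))
    (fun n => aemeasurable_const)
  simp only [zero_smul, add_zero] at h1
  refine TendstoInMeasure.congr' ?_ EventuallyEq.rfl h1.tendstoInMeasure_of_const
  filter_upwards [hρ.eventually_gt_atTop 0] with n hn
  refine Eventually.of_forall fun ω => ?_
  simp [smul_smul, inv_mul_cancel₀ hn.ne']

/-- The delta method. -/
lemma MeasureTheory.TendstoInDistribution.delta_method {φ : E → F} {L : E →L[ℝ] F} {s : Set E}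
    {a : E} (hφ : HasFDerivWithinAt φ L s a) {ρ : ℕ → ℝ} (hρ : Tendsto ρ atTop atTop)
    {q : ℕ → Ω → E} (hqs : ∀ n, ∀ᵐ ω ∂μ, q n ω ∈ s) (hq : ∀ n, AEMeasurable (q n) μ)
    (hφq : ∀ n, AEMeasurable (fun ω => φ (q n ω)) μ) {Z : Ω' → E}
    (h : TendstoInDistribution (fun n ω => ρ n • (q n ω - a)) atTop Z (fun _ => μ) ν) :
    TendstoInDistribution (fun n ω => ρ n • (φ (q n ω) - φ a)) atTop (fun ω' => L (Z ω'))
      (fun _ => μ) ν := by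
  -- The normalised Taylor remainder; its value at `a` is `0`, which is also its limit within `s`.
  let s₀ : E → ℝ := fun x => ‖x - a‖⁻¹ * ‖φ x - φ a - L (x - a)‖
  have hs₀ : ContinuousWithinAt s₀ s a := by
    have := hasFDerivWithinAt_iff_tendsto.1 hφ
    simpa [ContinuousWithinAt, s₀] using this
  have hsq := (h.tendstoInMeasure_of_smul_sub hρ).comp_continuousWithinAt hqs hs₀
  have hLq : ∀ n, AEMeasurable (fun ω => L (q n ω - a)) μ := fun n =>
    L.continuous.measurable.comp_aemeasurable ((hq n).sub_const a)
  -- The scaled remainder has norm `‖ρ n • (q n - a)‖ * s₀ (q n)`: a factor converging in law times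
  -- one tending to `0` in probability.
  have h1 := h.continuous_comp_prodMk_of_tendstoInMeasure_const
    (g := fun x : E × ℝ => ‖x.1‖ * x.2) (by fun_prop) hsq
    (fun n => ((hq n).sub_const a).norm.inv.mul (((hφq n).sub_const (φ a)).sub (hLq n)).norm)
  have ha : s₀ a = 0 := by simp [s₀]
  simp only [ha, mul_zero] at h1
  refine tendstoInDistribution_of_tendstoInMeasure_sub _ _ (h.continuous_comp L.continuous) ?_
    fun n => ((hφq n).sub_const (φ a)).const_smul (ρ n)
  have h2 := h1.tendstoInMeasure_of_const
  rw [tendstoInMeasure_iff_norm] at h2 ⊢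
  have hnorm : ∀ n ω, ‖(ρ n • (φ (q n ω) - φ a)) - L (ρ n • (q n ω - a))‖ =
      ‖‖ρ n • (q n ω - a)‖ * s₀ (q n ω)‖ := by
    intro n ω
    rw [map_smul, ← smul_sub, norm_smul, norm_mul, norm_norm, norm_smul]
    by_cases hqa : q n ω - a = 0
    · rw [sub_eq_zero] at hqa
      simp [hqa]
    · have : ‖q n ω - a‖ ≠ 0 := norm_ne_zero_iff.2 hqa
      simp only [s₀, norm_mul, norm_inv, norm_norm]
      field_simp
  intro ε hε
  refine (h2 ε hε).congr fun n => ?_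
  simp only [sub_zero, Pi.sub_apply, Pi.zero_apply, Function.comp_apply]
  simp only [hnorm]

end ConvergenceLemmas

/-! ### Linear images of Gaussian laws and the multivariate central limit theorem. -/

section Gaussian

open scoped Matrix RealInnerProductSpace

variable {ι : Type*} [Fintype ι] [DecidableEq ι]

lemma map_toEuclideanCLM_multivariateGaussian {C : Matrix ι ι ℝ} (hC : C.PosSemidef)
    (J : Matrix ι ι ℝ) :
    (multivariateGaussian 0 C).map (Matrix.toEuclideanCLM (𝕜 := ℝ) J) =
      multivariateGaussian 0 (J * C * Jᵀ) := by
  refine Measure.ext_of_charFun (funext fun t => ?_)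
  have hJ : (J * C * Jᵀ).PosSemidef := by simpa using hC.mul_mul_conjTranspose_same J
  have hin : ∀ x : EuclideanSpace ℝ ι, ⟪Matrix.toEuclideanCLM (𝕜 := ℝ) J x, t⟫ =
      ⟪x, Matrix.toEuclideanCLM (𝕜 := ℝ) Jᵀ t⟫ := by
    intro x
    rw [real_inner_comm, Matrix.inner_toEuclideanCLM, Matrix.inner_toEuclideanCLM,
      Matrix.dotProduct_mulVec, ← Matrix.mulVec_transpose, dotProduct_comm]
  have h1 : charFun ((multivariateGaussian 0 C).map (Matrix.toEuclideanCLM (𝕜 := ℝ) J)) t =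
      charFun (multivariateGaussian 0 C) (Matrix.toEuclideanCLM (𝕜 := ℝ) Jᵀ t) := by
    rw [charFun_apply, charFun_apply, integral_map (by fun_prop) (by fun_prop)]
    simp only [hin]
  rw [h1, charFun_multivariateGaussian hC, charFun_multivariateGaussian hJ]
  simp only [inner_zero_right]
  rw [toEuclideanCLM_apply_ofLp]
  simp only [← Matrix.mulVec_mulVec]
  rw [Matrix.dotProduct_mulVec (WithLp.ofLp t) J, ← Matrix.mulVec_transpose]

variable {Ω : Type*} [MeasurableSpace Ω] {μ : Measure Ω} [IsProbabilityMeasure μ]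

/-- The central limit theorem in `EuclideanSpace ℝ ι`. -/
lemma tendstoInDistribution_multivariateGaussian {Y : ℕ → Ω → EuclideanSpace ℝ ι}
    (hY : MemLp (Y 0) 2 μ) (hindep : iIndepFun Y μ) (hident : ∀ n, IdentDistrib (Y n) (Y 0) μ μ)
    {m : EuclideanSpace ℝ ι} {C : Matrix ι ι ℝ} (hC : C.PosSemidef)
    (hm : ∀ t, μ[fun ω => ⟪t, Y 0 ω⟫] = ⟪t, m⟫)
    (hvar : ∀ t, Var[fun ω => ⟪t, Y 0 ω⟫; μ] = t ⬝ᵥ C *ᵥ t) :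
    TendstoInDistribution
      (fun (n : ℕ) ω => (√(n : ℝ))⁻¹ • (∑ k ∈ Finset.range n, Y k ω - (n : ℝ) • m)) atTop id
      (fun _ => μ) (multivariateGaussian 0 C) where
  forall_aemeasurable n := AEMeasurable.const_smul ((Finset.aemeasurable_fun_sum _ fun k _ =>
    (hident k).aemeasurable_fst).sub_const ((n : ℝ) • m)) (√(n : ℝ))⁻¹
  aemeasurable_limit := aemeasurable_id
  tendsto := by
    refine ProbabilityMeasure.tendsto_iff_tendsto_charFun.2 fun t => ?_
    have hmeas : ∀ k, AEMeasurable (Y k) μ := fun k => (hident k).aemeasurable_fst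
    -- Cramér–Wold: the characteristic function at `t` is that of the projection on `t`, evaluated
    -- at `1`.
    have hclt := tendstoInDistribution_inv_sqrt_mul_sum_sub (P := μ)
      (X := fun k ω => ⟪t, Y k ω⟫) HasLaw.id (hY.const_inner t)
      (hindep.comp (fun _ y => ⟪t, y⟫) (by fun_prop))
      (fun k => (hident k).comp (u := fun y => ⟪t, y⟫) (by fun_prop))
    have h1 := ProbabilityMeasure.tendsto_iff_tendsto_charFun.1 hclt.tendsto 1
    simp only [ProbabilityMeasure.coe_mk, Measure.map_id, charFun_gaussianReal] at h1 ⊢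
    rw [charFun_multivariateGaussian hC]
    convert h1 using 2 with n
    · rw [charFun_apply, charFun_apply_real, integral_map, integral_map]
      · refine integral_congr_ae (Eventually.of_forall fun ω => ?_)
        have hin : ⟪(√(n : ℝ))⁻¹ • (∑ k ∈ Finset.range n, Y k ω - (n : ℝ) • m), t⟫ =
            (√(n : ℝ))⁻¹ * (∑ k ∈ Finset.range n, ⟪t, Y k ω⟫ - n * μ[fun ω => ⟪t, Y 0 ω⟫]) := by
          rw [real_inner_comm, real_inner_smul_right, inner_sub_right, inner_sum,
            real_inner_smul_right, hm]
        simp only [hin, Complex.ofReal_one, one_mul]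
      · exact Finset.aemeasurable_fun_sum _ (fun k _ => (hmeas k).const_inner)
          |>.sub_const _ |>.const_mul _
      · fun_prop
      · exact AEMeasurable.const_smul ((Finset.aemeasurable_fun_sum _ fun k _ =>
          hmeas k).sub_const ((n : ℝ) • m)) (√(n : ℝ))⁻¹
      · fun_prop
    · rw [hvar, Real.coe_toNNReal _ (hvar t ▸ variance_nonneg _ _)]
      simp

end Gaussian

/-! ### The smoothed empirical array: support, measurability and limit law. -/

section EmpiricalArray

open scoped Matrix RealInnerProductSpace

variable {d : ℕ} {r : Fin d → ℕ}

/-- When `S` meets every slice, positivity on `S` already forces positive margins. -/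
lemma mem_probArraysOn_iff {S : Finset (Cell r)} (hS : ∀ l (i : Fin (r l)), ∃ j ∈ S, j l = i)
    {q : RArray r} :
    q ∈ probArraysOn S ↔ (∀ i ∈ S, 0 < q i) ∧ (∀ i, i ∉ S → q i = 0) ∧ ∑ i, q i = 1 := by
  constructor
  · exact fun hq => ⟨fun i => pos_of_mem_probArraysOn hq, fun i => eq_zero_of_mem_probArraysOn hq,
      hq.1.2.1⟩
  · rintro ⟨h1, h2, h3⟩
    have h0 : ∀ i, 0 ≤ q i := fun i => by
      by_cases hi : i ∈ S
      · exact (h1 i hi).le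
      · exact (h2 i hi).ge
    refine ⟨⟨fun i => ⟨h0 i, le_one_of_sum_eq_one h0 h3 i⟩, h3, fun l i => ?_⟩, ?_⟩
    · obtain ⟨j, hj, hjl⟩ := hS l i
      exact Finset.sum_pos' (fun j _ => h0 j) ⟨j, by simp [hjl], h1 j hj⟩
    · ext i
      rw [mem_supp]
      by_cases hi : i ∈ S
      · simp [hi, (h1 i hi).ne']
      · simp [hi, h2 i hi]

lemma exists_mem_supp_of_mem_probArrays {p : RArray r} (hp : p ∈ probArrays r) (l : Fin d)
    (i : Fin (r l)) : ∃ j ∈ supp p, j l = i := by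
  obtain ⟨j, hj, hj0⟩ := Finset.exists_ne_zero_of_sum_ne_zero (hp.2.2 l i).ne'
  exact ⟨j, mem_supp.2 hj0, (Finset.mem_filter.1 hj).2⟩

lemma measurableSet_probArraysOn {S : Finset (Cell r)}
    (hS : ∀ l (i : Fin (r l)), ∃ j ∈ S, j l = i) : MeasurableSet (probArraysOn S) := by
  have : probArraysOn S = {q : RArray r | (∀ i ∈ S, 0 < q i) ∧ (∀ i, i ∉ S → q i = 0) ∧
    ∑ i, q i = 1} := Set.ext fun q => mem_probArraysOn_iff hS
  rw [this]
  simp only [Set.ofPred_and, Set.ofPred_forall]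
  refine (MeasurableSet.iInter fun i => MeasurableSet.iInter fun _ =>
    measurableSet_lt measurable_const (measurable_pi_apply i)).inter
    ((MeasurableSet.iInter fun i => MeasurableSet.iInter fun _ =>
      measurableSet_eq_fun (measurable_pi_apply i) measurable_const).inter
    (measurableSet_eq_fun (by fun_prop) measurable_const))

lemma gridPoint_injective {x : (l : Fin d) → Fin (r l) → ℝ} (hx : ∀ l, StrictMono (x l)) :
    Function.Injective (gridPoint x : Cell r → Fin d → ℝ) :=
  fun _ _ h => funext fun l => (hx l).injective (congrFun h l)

/-- The array of indicators of the cells, as a function of the observation. -/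
noncomputable def cellIndicator (x : (l : Fin d) → Fin (r l) → ℝ) (y : Fin d → ℝ) : RArray r :=
  fun i => Set.indicator {gridPoint x i} (fun _ => (1 : ℝ)) y

lemma measurable_cellIndicator (x : (l : Fin d) → Fin (r l) → ℝ) :
    Measurable (cellIndicator x : (Fin d → ℝ) → RArray r) :=
  measurable_pi_lambda _ fun _ => measurable_const.indicator (measurableSet_singleton _)

lemma empArray_eq (x : (l : Fin d) → Fin (r l) → ℝ) {Ω : Type*} (X : ℕ → Ω → Fin d → ℝ) (n : ℕ)
    (ω : Ω) : empArray x X n ω =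
      (1 / (n : ℝ)) • ∑ k ∈ Finset.range n, cellIndicator (r := r) x (X k ω) := by
  ext i
  simp [empArray, cellIndicator]

lemma cellIndicator_gridPoint {x : (l : Fin d) → Fin (r l) → ℝ} (hx : ∀ l, StrictMono (x l))
    (j : Cell r) : cellIndicator x (gridPoint x j) = Pi.single j 1 := by
  ext i
  simp only [cellIndicator, Set.indicator_apply, Set.mem_singleton_iff,
    (gridPoint_injective hx).eq_iff, Pi.single_apply, eq_comm]

/-- The entries of `p` sum to one, so the grid points of its support carry all the mass of `P`. -/
lemma ae_mem_image_gridPoint {x : (l : Fin d) → Fin (r l) → ℝ} (hx : ∀ l, StrictMono (x l))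
    {P : Measure (Fin d → ℝ)} [IsProbabilityMeasure P] {p : RArray r} (hp : p = probArray x P)
    (hp1 : ∑ i, p i = 1) : ∀ᵐ y ∂P, ∃ j ∈ supp p, gridPoint x j = y := by
  have hT : P.real ((supp p).image (gridPoint x)) = 1 := by
    rw [← MeasureTheory.sum_measureReal_singleton,
      Finset.sum_image (gridPoint_injective hx).injOn, ← hp1]
    refine Finset.sum_subset_zero_on_sdiff (Finset.subset_univ _) (fun i hi => ?_) fun i _ => ?_
    · simpa [mem_supp] using hi
    · rw [hp]
      rfl
  have h1 : P ((supp p).image (gridPoint x) : Set (Fin d → ℝ)) = 1 := by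
    rwa [measureReal_def, ENNReal.toReal_eq_one_iff] at hT
  have h2 : ∀ᵐ y ∂P, y ∈ ((supp p).image (gridPoint x) : Set (Fin d → ℝ)) :=
    mem_ae_iff.2 ((prob_compl_eq_zero_iff (Finset.measurableSet _)).2 h1)
  filter_upwards [h2] with y hy
  exact Finset.mem_image.1 hy

/-- The empirical part charges only cells of `S`, and the uniform part charges all of them. -/
lemma smoothedArray_mem_probArraysOn {x : (l : Fin d) → Fin (r l) → ℝ}
    (hx : ∀ l, StrictMono (x l)) {S : Finset (Cell r)}
    (hS : ∀ l (i : Fin (r l)), ∃ j ∈ S, j l = i) (hne : S.Nonempty) {Ω : Type*}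
    {X : ℕ → Ω → Fin d → ℝ}
    {ω : Ω} (hω : ∀ k, ∃ j ∈ S, gridPoint x j = X k ω) (n : ℕ) :
    smoothedArray x S X n ω ∈ probArraysOn S := by
  choose j hjS hj using hω
  have hE : ∀ i, empArray x X n ω i =
      (1 / (n : ℝ)) * ∑ k ∈ Finset.range n, (Pi.single (j k) 1 : RArray r) i := by
    intro i
    rw [empArray_eq]
    simp only [← hj, cellIndicator_gridPoint hx, Pi.smul_apply, Finset.sum_apply, smul_eq_mul]
  have hcard : 0 < (S.card : ℝ) := by exact_mod_cast hne.card_pos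
  rw [mem_probArraysOn_iff hS]
  refine ⟨fun i hi => ?_, fun i hi => ?_, ?_⟩
  · have h0 : 0 ≤ empArray x X n ω i := by
      rw [hE]
      refine mul_nonneg (by positivity) (Finset.sum_nonneg fun k _ => ?_)
      rw [Pi.single_apply]
      split_ifs <;> norm_num
    simp only [smoothedArray, unifArray, Pi.add_apply, Pi.smul_apply, smul_eq_mul, if_pos hi]
    positivity
  · have h0 : empArray x X n ω i = 0 := by
      rw [hE, Finset.sum_eq_zero fun k _ => ?_, mul_zero]
      rw [Pi.single_apply, if_neg]
      rintro rfl
      exact hi (hjS k)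
    simp [smoothedArray, unifArray, h0, hi]
  · have h1 : ∑ i, empArray x X n ω i = (1 / (n : ℝ)) * n := by
      simp only [hE, ← Finset.mul_sum]
      rw [Finset.sum_comm]
      simp
    have h2 : ∑ i, unifArray S i = 1 := by
      simp [unifArray, hcard.ne']
    simp only [smoothedArray, Pi.add_apply, Pi.smul_apply, smul_eq_mul, Finset.sum_add_distrib,
      ← Finset.mul_sum, h1, h2]
    -- For `n = 0` the convention `1 / 0 = 0` makes the empirical array null, and the uniform array
    -- has weight one.
    rcases Nat.eq_zero_or_pos n with rfl | hn
    · simp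
    · have : (0 : ℝ) < n := by exact_mod_cast hn
      field_simp

lemma aemeasurable_smoothedArray (x : (l : Fin d) → Fin (r l) → ℝ) (S : Finset (Cell r))
    {Ω : Type*} [MeasurableSpace Ω] {μ : Measure Ω}
    {X : ℕ → Ω → Fin d → ℝ} (hX : ∀ n, AEMeasurable (X n) μ) (n : ℕ) :
    AEMeasurable (smoothedArray x S X n) μ := by
  have : smoothedArray x S X n = fun ω => ((n : ℝ) / ((n : ℝ) + 1)) •
      ((1 / (n : ℝ)) • ∑ k ∈ Finset.range n, cellIndicator x (X k ω)) +
        (1 / ((n : ℝ) + 1)) • unifArray S := by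
    ext1 ω
    rw [smoothedArray, empArray_eq]
  rw [this]
  have h : AEMeasurable (fun ω => ∑ k ∈ Finset.range n, cellIndicator (r := r) x (X k ω)) μ :=
    Finset.aemeasurable_fun_sum _ fun k _ => (measurable_cellIndicator x).comp_aemeasurable (hX k)
  have h' := (h.const_smul (1 / (n : ℝ))).const_smul ((n : ℝ) / ((n : ℝ) + 1))
  exact h'.add_const _

lemma measurable_vec : Measurable (vec : RArray r → VecSpace r) :=
  (PiLp.continuous_toLp 2 _).measurable

lemma integral_inner_cellIndicator {x : (l : Fin d) → Fin (r l) → ℝ} {P : Measure (Fin d → ℝ)}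
    [IsProbabilityMeasure P] (t : RArray r) :
    ∫ y, ∑ i, t i * cellIndicator x y i ∂P = ∑ i, t i * probArray x P i := by
  rw [integral_finsetSum]
  · refine Finset.sum_congr rfl fun i _ => ?_
    rw [integral_const_mul]
    congr 1
    exact integral_indicator_one (measurableSet_singleton _)
  · exact fun i _ => ((integrable_const 1).indicator (measurableSet_singleton _)).const_mul _

/-- At most one cell indicator is nonzero at a given point, so the cross terms vanish. -/
lemma sum_mul_cellIndicator_sq {x : (l : Fin d) → Fin (r l) → ℝ} (hx : ∀ l, StrictMono (x l))
    (t : RArray r) (y : Fin d → ℝ) :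
    (∑ i, t i * cellIndicator x y i) ^ 2 = ∑ i, t i ^ 2 * cellIndicator x y i := by
  by_cases h : ∃ j : Cell r, gridPoint x j = y
  · obtain ⟨j, rfl⟩ := h
    simp [cellIndicator_gridPoint hx, Pi.single_apply]
  · have h0 : cellIndicator (r := r) x y = 0 := by
      ext i
      exact Set.indicator_of_notMem (fun hy => h ⟨i, hy.symm⟩) _
    simp [h0]

lemma memLp_cellIndicator (x : (l : Fin d) → Fin (r l) → ℝ) {P : Measure (Fin d → ℝ)}
    [IsProbabilityMeasure P] : MemLp (fun y => vec (cellIndicator (r := r) x y)) 2 P := by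
  refine MemLp.of_bound (measurable_vec.comp (measurable_cellIndicator x)).aestronglyMeasurable
    (√(∑ _i : Cell r, 1)) (Eventually.of_forall fun y => ?_)
  rw [EuclideanSpace.norm_eq]
  refine Real.sqrt_le_sqrt (Finset.sum_le_sum fun i _ => ?_)
  simp only [vec, cellIndicator, Set.indicator_apply]
  split_ifs <;> simp

lemma inner_vec (t : VecSpace r) (a : RArray r) : ⟪t, vec a⟫ = ∑ i, t i * a i := by
  simp [vec, PiLp.inner_apply, mul_comm]

lemma dotProduct_multinomialCov_mulVec (p t : RArray r) :
    t ⬝ᵥ multinomialCov p *ᵥ t = ∑ i, t i ^ 2 * p i - (∑ i, t i * p i) ^ 2 := by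
  rw [multinomialCov, Matrix.sub_mulVec, dotProduct_sub, Matrix.vecMulVec_mulVec]
  congr 1
  · simp only [dotProduct, Matrix.mulVec_diagonal]
    exact Finset.sum_congr rfl fun i _ => by ring
  · simp only [dotProduct, Pi.smul_apply, MulOpposite.smul_eq_mul_unop, MulOpposite.unop_op]
    rw [sq, Finset.sum_mul]
    refine Finset.sum_congr rfl fun i _ => ?_
    rw [mul_assoc]
    congr 2
    exact Finset.sum_congr rfl fun i _ => mul_comm _ _

lemma variance_inner_cellIndicator {x : (l : Fin d) → Fin (r l) → ℝ} (hx : ∀ l, StrictMono (x l))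
    {P : Measure (Fin d → ℝ)} [IsProbabilityMeasure P] (t : VecSpace r) :
    Var[fun y => ⟪t, vec (cellIndicator x y)⟫; P] =
      t ⬝ᵥ multinomialCov (probArray x P) *ᵥ t := by
  rw [variance_eq_sub ((memLp_cellIndicator x).const_inner t), dotProduct_multinomialCov_mulVec]
  simp only [Pi.pow_apply, inner_vec, sum_mul_cellIndicator_sq hx, integral_inner_cellIndicator]

/-- The quadratic form is the variance of a linear combination of the cell indicators. -/
lemma posSemidef_multinomialCov {x : (l : Fin d) → Fin (r l) → ℝ} (hx : ∀ l, StrictMono (x l))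
    (P : Measure (Fin d → ℝ)) [IsProbabilityMeasure P] :
    (multinomialCov (r := r) (probArray x P)).PosSemidef := by
  refine Matrix.PosSemidef.of_dotProduct_mulVec_nonneg ?_ fun t => ?_
  · rw [multinomialCov, Matrix.IsHermitian, Matrix.conjTranspose_sub, Matrix.conjTranspose_vecMulVec,
      Matrix.diagonal_conjTranspose]
    simp
  · have := variance_inner_cellIndicator hx (P := P) (WithLp.toLp 2 t : VecSpace r)
    simp only [star_trivial]
    exact this ▸ variance_nonneg _ _

/-- The central limit theorem for the smoothed empirical array. -/
lemma tendstoInDistribution_smoothedArray {x : (l : Fin d) → Fin (r l) → ℝ}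
    (hx : ∀ l, StrictMono (x l)) {P : Measure (Fin d → ℝ)} [IsProbabilityMeasure P]
    {p : RArray r} (hp : p = probArray x P) (S : Finset (Cell r))
    {Ω : Type*} [MeasurableSpace Ω] {μ : Measure Ω} [IsProbabilityMeasure μ]
    {X : ℕ → Ω → Fin d → ℝ} (hX : ∀ n, HasLaw (X n) P μ) (hindep : iIndepFun X μ) :
    TendstoInDistribution
      (fun (n : ℕ) ω => √(n : ℝ) • (vec (smoothedArray x S X n ω) - vec p))
      atTop id (fun _ => μ) (multivariateGaussian 0 (multinomialCov p)) := by
  have hφ : Measurable fun y => vec (cellIndicator (r := r) x y) :=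
    measurable_vec.comp (measurable_cellIndicator x)
  have hL : MemLp (fun y => vec (cellIndicator (r := r) x y)) 2 (μ.map (X 0)) := by
    rw [(hX 0).map_eq]
    exact memLp_cellIndicator x
  have hXi : ∀ n, IdentDistrib (X n) (X 0) μ μ := fun n =>
    ⟨(hX n).aemeasurable, (hX 0).aemeasurable, (hX n).map_eq.trans (hX 0).map_eq.symm⟩
  have hclt := tendstoInDistribution_multivariateGaussian (μ := μ)
    (Y := fun k ω => vec (cellIndicator (r := r) x (X k ω))) (m := vec p) (C := multinomialCov p)
    (hL.comp_of_map (hX 0).aemeasurable)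
    (hindep.comp (fun _ y => vec (cellIndicator x y)) fun _ => hφ)
    (fun n => (hXi n).comp hφ)
    (hp ▸ posSemidef_multinomialCov hx P)
    (fun t => by
      have h := (hX 0).integral_comp (f := fun y => ⟪t, vec (cellIndicator x y)⟫)
        ((memLp_cellIndicator x).const_inner t).aestronglyMeasurable
      simp only [Function.comp_def] at h
      rw [h]
      simp only [inner_vec, integral_inner_cellIndicator, hp])
    (fun t => by
      have h := variance_map (μ := μ) (X := fun y => ⟪t, vec (cellIndicator (r := r) x y)⟫)
        (Y := X 0) (hφ.const_inner (c := t)).aemeasurable (hX 0).aemeasurable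
      rw [(hX 0).map_eq, variance_inner_cellIndicator hx, ← hp] at h
      exact h.symm)
  -- Smoothing multiplies the empirical fluctuation by `n / (n + 1)` and adds `√n / (n + 1)` times
  -- the fixed difference between the uniform array and `p`.
  have hn : Tendsto (fun n : ℕ => ((n : ℝ) / (n + 1), √(n : ℝ) / (n + 1))) atTop
      (𝓝 ((1 : ℝ), (0 : ℝ))) := by
    refine (tendsto_natCast_div_add_atTop (1 : ℝ)).prodMk_nhds ?_
    have h1 : Tendsto (fun n : ℕ => (√(n : ℝ))⁻¹) atTop (𝓝 0) :=
      tendsto_inv_atTop_zero.comp (Real.tendsto_sqrt_atTop.comp tendsto_natCast_atTop_atTop)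
    refine squeeze_zero (fun n => by positivity) (fun n => ?_) h1
    rcases Nat.eq_zero_or_pos n with rfl | hn
    · simp
    · have h2 : (0 : ℝ) < √(n : ℝ) := Real.sqrt_pos.2 (by exact_mod_cast hn)
      rw [div_le_iff₀ (by positivity), inv_mul_eq_div, le_div_iff₀ h2,
        Real.mul_self_sqrt (Nat.cast_nonneg n)]
      linarith
  have h := hclt.continuous_comp_prodMk_of_tendstoInMeasure_const
    (g := fun z : VecSpace r × (ℝ × ℝ) => z.2.1 • z.1 + z.2.2 • (vec (unifArray S) - vec p))
    (by fun_prop) (tendstoInMeasure_const_of_tendsto hn) (fun n => aemeasurable_const)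
  simp only [one_smul, zero_smul, add_zero] at h
  refine h.congr (fun n => Eventually.of_forall fun ω => ?_) EventuallyEq.rfl
  ext i
  simp only [vec, smoothedArray, empArray_eq, PiLp.add_apply, PiLp.smul_apply, PiLp.sub_apply,
    smul_eq_mul, Pi.add_apply, Pi.smul_apply, WithLp.ofLp_sum, Finset.sum_apply]
  rcases Nat.eq_zero_or_pos n with rfl | hn
  · simp
  · have h1 : (0 : ℝ) < n := by exact_mod_cast hn
    have h2 : √(n : ℝ) ≠ 0 := (Real.sqrt_pos.2 h1).ne'
    have h3 : √(n : ℝ) ^ 2 = n := Real.sq_sqrt h1.le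
    generalize √(n : ℝ) = s at *
    rw [← h3]
    field_simp
    ring

end EmpiricalArray

/-! ### Reduction of the limit covariance to the sandwich form. -/

section Covariance

open scoped Matrix

variable {d : ℕ} {r : Fin d → ℕ} {S : Finset (Cell r)} {k : ℕ}

lemma transpose_infoMatrix (b : Module.Basis (Fin k) ℝ (nullMarginSpace S)) (v : RArray r) :
    (infoMatrix b v)ᵀ = infoMatrix b v := by
  simp [infoMatrix, diagInv, Matrix.mul_assoc]

/-- Weighting `p` by its inverse gives the constant `1` on `S`, and every basis array sums to zero.
-/
lemma copulaJacobian_mulVec_self (hd : 1 ≤ d) {p : RArray r} (hp : p ∈ probArraysOn S)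
    (b : Module.Basis (Fin k) ℝ (nullMarginSpace S)) : copulaJacobian b p *ᵥ p = 0 := by
  have h : ((redMatrix b)ᵀ * diagInv (selMatrix S *ᵥ p) * selMatrix S) *ᵥ p = 0 := by
    ext m
    rw [transpose_mul_diagInv_mulVec, Pi.zero_apply,
      ← sum_eq_zero_of_mem_nullMarginSpace hd (b m).2,
      ← Finset.sum_subset (Finset.subset_univ S)
        fun i _ hi => supp_subset_iff.1 (b m).2.1 i hi, ← Finset.sum_coe_sort S]
    refine Finset.sum_congr rfl fun i _ => ?_
    rw [inv_mul_cancel₀ (pos_of_mem_probArraysOn hp i.2).ne', mul_one]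
  have h2 : copulaJacobian b p = basisMatrix b * (infoMatrix b (copulaArray p))⁻¹ *
      ((redMatrix b)ᵀ * diagInv (selMatrix S *ᵥ p) * selMatrix S) := by
    simp only [copulaJacobian, Matrix.mul_assoc]
  rw [h2, ← Matrix.mulVec_mulVec, h, Matrix.mulVec_zero]

/-- The term `p pᵀ` is annihilated by `J`; in the remaining diagonal part, `diag⁻¹(R p) diag(R p)
diag⁻¹(R p)` collapses to one inverse. -/
lemma copulaJacobian_mul_multinomialCov_mul_transpose (hd : 1 ≤ d) {p : RArray r}
    (hp : p ∈ probArraysOn S) (b : Module.Basis (Fin k) ℝ (nullMarginSpace S)) :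
    copulaJacobian b p * multinomialCov p * (copulaJacobian b p)ᵀ = sigmaGamma b p := by
  have hR : selMatrix S * (Matrix.diagonal p * (selMatrix S)ᵀ) =
      Matrix.diagonal fun i : S => p i := by
    ext i j
    rw [Matrix.mul_apply]
    simp only [Matrix.diagonal_mul, Matrix.transpose_apply, selMatrix, Matrix.submatrix_apply,
      id_eq, Matrix.one_apply, Matrix.diagonal_apply, ite_mul, one_mul, zero_mul,
      Finset.sum_ite_eq, Finset.mem_univ, if_true, Subtype.coe_inj, mul_ite, mul_one, mul_zero]
    by_cases h : i = j
    · simp [h]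
    · simp [h]
  have hD : diagInv (selMatrix S *ᵥ p) * ((Matrix.diagonal fun i : S => p i) *
      diagInv (selMatrix S *ᵥ p)) = diagInv (selMatrix S *ᵥ p) := by
    rw [selMatrix_mulVec, diagInv, Matrix.diagonal_mul_diagonal, Matrix.diagonal_mul_diagonal]
    congr 1
    ext i
    rw [mul_inv_cancel₀ (pos_of_mem_probArraysOn hp i.2).ne', mul_one]
  have hDt : (diagInv (selMatrix S *ᵥ p))ᵀ = diagInv (selMatrix S *ᵥ p) :=
    Matrix.diagonal_transpose _
  rw [multinomialCov, Matrix.mul_sub, Matrix.mul_vecMulVec, copulaJacobian_mulVec_self hd hp b,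
    Matrix.zero_vecMulVec, sub_zero]
  have hJt : (copulaJacobian b p)ᵀ = (selMatrix S)ᵀ * (diagInv (selMatrix S *ᵥ p) *
      (redMatrix b * ((infoMatrix b (copulaArray p))⁻¹ * (basisMatrix b)ᵀ))) := by
    rw [copulaJacobian, Matrix.transpose_mul, Matrix.transpose_mul, Matrix.transpose_mul,
      Matrix.transpose_mul, Matrix.transpose_transpose, hDt, Matrix.transpose_nonsing_inv,
      transpose_infoMatrix]
  calc copulaJacobian b p * Matrix.diagonal p * (copulaJacobian b p)ᵀ
      = basisMatrix b * (infoMatrix b (copulaArray p))⁻¹ * (redMatrix b)ᵀ *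
          (diagInv (selMatrix S *ᵥ p) * ((selMatrix S * (Matrix.diagonal p * (selMatrix S)ᵀ)) *
            diagInv (selMatrix S *ᵥ p))) * redMatrix b * (infoMatrix b (copulaArray p))⁻¹ *
          (basisMatrix b)ᵀ := by
        rw [hJt, copulaJacobian]
        simp only [Matrix.mul_assoc]
    _ = sigmaGamma b p := by
        rw [hR, hD]
        simp only [sigmaGamma, sigmaTheta, infoMatrix, Matrix.mul_assoc]

end Covariance

/-! ### Assembly of the theorem. -/

theorem mainTheorem1 {d : ℕ} (hd : 1 ≤ d) (r : Fin d → ℕ)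
    (x : (l : Fin d) → Fin (r l) → ℝ) (hx : ∀ l, StrictMono (x l))
    (P : Measure (Fin d → ℝ)) [IsProbabilityMeasure P]
    (p : RArray r) (hp : p = probArray x P) (hpP : p ∈ probArrays r)
    (hΓ : (copulaArraysOn (supp p)).Nonempty)
    {Ω : Type*} [MeasurableSpace Ω] (μ : Measure Ω) [IsProbabilityMeasure μ]
    (X : ℕ → Ω → Fin d → ℝ) (hX : ∀ n, HasLaw (X n) P μ)
    {Ω' : Type*} [MeasurableSpace Ω'] (ν : Measure Ω') [IsProbabilityMeasure ν] :
    -- the copula array is well defined for every probability array with the support of `p`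
    (∀ q ∈ probArraysOn (supp p), ∃! g, IsIProjection (copulaArrays r) q g) ∧
    -- (a) consistency and strong consistency
    (TendstoInMeasure μ (smoothedArray x (supp p) X) atTop (fun _ => p) →
      TendstoInMeasure μ (empCopulaArray x (supp p) X) atTop (fun _ => copulaArray p)) ∧
    ((∀ᵐ ω ∂μ, Tendsto (fun n => smoothedArray x (supp p) X n ω) atTop (𝓝 p)) →
      ∀ᵐ ω ∂μ, Tendsto (fun n => empCopulaArray x (supp p) X n ω) atTop (𝓝 (copulaArray p))) ∧
    (1 ≤ Module.finrank ℝ (nullMarginSpace (supp p)) →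
      ∀ (k : ℕ) (b : Module.Basis (Fin k) ℝ (nullMarginSpace (supp p))),
      -- the matrix in (b) is the Jacobian matrix of the copula map at `p`
      HasFDerivWithinAt copulaMap (Matrix.toEuclideanCLM (𝕜 := ℝ) (copulaJacobian b p))
        (vec '' probArraysOn (supp p)) (vec p) ∧
      -- (b) limit in law
      (∀ (ρ : ℕ → ℝ) (Z : Ω' → VecSpace r), Tendsto ρ atTop atTop →
        TendstoInDistribution
          (fun n ω => ρ n • (vec (smoothedArray x (supp p) X n ω) - vec p))
          atTop Z (fun _ => μ) ν →
        TendstoInDistribution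
          (fun n ω => ρ n • (vec (empCopulaArray x (supp p) X n ω) - vec (copulaArray p)))
          atTop (fun ω' => Matrix.toEuclideanCLM (𝕜 := ℝ) (copulaJacobian b p) (Z ω'))
          (fun _ => μ) ν) ∧
      -- (c) asymptotic normality for independent and identically distributed observations
      (iIndepFun X μ →
        (multinomialCov p).PosSemidef ∧
        TendstoInDistribution
          (fun (n : ℕ) ω => √(n : ℝ) • (vec (smoothedArray x (supp p) X n ω) - vec p))
          atTop id (fun _ => μ) (multivariateGaussian 0 (multinomialCov p)) ∧
        (sigmaGamma b p).PosSemidef ∧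
        TendstoInDistribution
          (fun (n : ℕ) ω =>
            √(n : ℝ) • (vec (empCopulaArray x (supp p) X n ω) - vec (copulaArray p)))
          atTop id (fun _ => μ) (multivariateGaussian 0 (sigmaGamma b p)))) := by
  have hpS : p ∈ probArraysOn (supp p) := ⟨hpP, rfl⟩
  have hne := hΓ.mono (copulaArraysOn_subset_copulaArraysIn (supp p))
  have hS := exists_mem_supp_of_mem_probArrays hpP
  have hSne : (supp p).Nonempty := by
    rw [Finset.nonempty_iff_ne_empty]
    intro h
    have h0 : ∑ i, p i = 0 := Finset.sum_eq_zero fun i _ =>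
      supp_subset_iff.1 h.le i (Finset.notMem_empty i)
    exact zero_ne_one (h0.symm.trans hpP.2.1)
  -- One null set serves all `n`, as strong consistency requires.
  have hmem : ∀ᵐ ω ∂μ, ∀ n, smoothedArray x (supp p) X n ω ∈ probArraysOn (supp p) := by
    have h : ∀ᵐ ω ∂μ, ∀ k, ∃ j ∈ supp p, gridPoint x j = X k ω :=
      ae_all_iff.2 fun k => ae_of_ae_map (hX k).aemeasurable
        ((hX k).map_eq ▸ ae_mem_image_gridPoint hx hp hpP.2.1)
    filter_upwards [h] with ω hω n using smoothedArray_mem_probArraysOn hx hS hSne hω n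
  have hmeas := aemeasurable_smoothedArray x (supp p) fun n => (hX n).aemeasurable
  have hcont := continuousOn_copulaArray hne
  refine ⟨fun q hq => existsUnique_isIProjection hq hne,
    fun h => h.comp_continuousWithinAt (ae_all_iff.1 hmem) (hcont p hpS), fun h => ?_,
    fun _ k b => ?_⟩
  · filter_upwards [h, hmem] with ω hω hωS
    exact (hcont p hpS).tendsto.comp
      (tendsto_nhdsWithin_iff.2 ⟨hω, Eventually.of_forall hωS⟩)
  have hder := hasFDerivWithinAt_copulaMap hd hpS hΓ b
  have hvmem : ∀ n, ∀ᵐ ω ∂μ,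
      vec (smoothedArray x (supp p) X n ω) ∈ vec '' probArraysOn (supp p) := fun n =>
    (ae_all_iff.1 hmem n).mono fun ω hω => Set.mem_image_of_mem vec hω
  have hvmeas : ∀ n, AEMeasurable (fun ω => vec (smoothedArray x (supp p) X n ω)) μ := fun n =>
    measurable_vec.comp_aemeasurable (hmeas n)
  have hgmeas : ∀ n, AEMeasurable (fun ω => copulaMap (vec (smoothedArray x (supp p) X n ω))) μ :=
    fun n => measurable_vec.comp_aemeasurable
      (hcont.aemeasurable_comp (measurableSet_probArraysOn hS) (hmeas n) (ae_all_iff.1 hmem n))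
  refine ⟨hder, fun ρ Z hρ h => h.delta_method hder hρ hvmem hvmeas hgmeas, fun hindep => ?_⟩
  have hC : (multinomialCov p).PosSemidef := hp ▸ posSemidef_multinomialCov hx P
  have hJ := copulaJacobian_mul_multinomialCov_mul_transpose hd hpS b
  have hclt := tendstoInDistribution_smoothedArray hx hp (supp p) hX hindep
  refine ⟨hC, hclt, ?_, ?_⟩
  · rw [← hJ]
    simpa using hC.mul_mul_conjTranspose_same (copulaJacobian b p)
  -- The delta method yields `J` applied to a Gaussian vector; only its law matters, so it is
  -- replaced by the identity under the image Gaussian law.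
  · refine (hclt.delta_method hder (Real.tendsto_sqrt_atTop.comp tendsto_natCast_atTop_atTop)
      hvmem hvmeas hgmeas).of_map_eq aemeasurable_id ?_
    rw [← hJ, Measure.map_id]
    exact map_toEuclideanCLM_multivariateGaussian hC _
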